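/- Let $n\ge 0$, let $\Gamma\subset\mathbb R^{n+1}$ be a lattice of maximal rank and let $T^{n+1}=\mathbb R^{n+1}/\Gamma$ be the flat torus, with its flat metric $\langle\cdot,\cdot\rangle$ and Levi-Civita connection $D$. Let $M^n$ be a closed (compact, without boundary), smoothly embedded, orientable minimal hypersurface in $T^{n+1}$ with a smooth unit normal field $N$, with the induced metric, Levi-Civita connection $\nabla$ and Laplace–Beltrami operator $\Delta u=\operatorname{tr}\nabla du$, and with second fundamental form $A(X,Y)=\langle D_XY,N\rangle$. Let $\omega$ be a smooth $1$-form on $M$ that is harmonic, i.e. $(dd^*+d^*d)\,\omega=0$, and let $\theta$ be a parallel $2$-form on $T^{n+1}$. Covectors of $M$ are regarded as covectors of $T^{n+1}$ along $M$ that vanish on $N$, and $\langle\cdot,\cdot\rangle$ also denotes the inner product of $2$-forms for which the forms $\varepsilon_a^\flat\wedge\varepsilon_b^\flat$, $a<b$, are orthonormal for every orthonormal basis $(\varepsilon_a)$. Then the function $u=\langle N^\flat\wedge\omega,\theta\rangle$ on $M$ is smooth and satisfies $$\Delta u+|A|^2u=-2\sum_{i,j=1}^n A(E_i,E_j)\,\langle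 E_j^\flat\wedge\nabla_{E_i}\omega,\theta\rangle$$ at every point, for every orthonormal frame $E_1,\dots,E_n$ of $M$ there; the right-hand side does not depend on the choice of the orthonormal frame. -/

import Mathlib

open scoped Manifold ContDiff

noncomputable section

namespace TorusHypersurface

/-- Euclidean space `ℝᵏ`. -/
abbrev Euc (k : ℕ) : Type := EuclideanSpace ℝ (Fin k)

/-! ### The flat torus `T = ℝᵏ / Γ` -/

section Torus

variable {k : ℕ}

/-- The torus `ℝᵏ / Γ`, as a topological group. It is used for a lattice `Γ` of maximal rank. -/
abbrev FlatTorus (Γ : Submodule ℤ (Euc k)) : Type := Euc k ⧸ Γ.toAddSubgroup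

theorem isLocalHomeomorph_mk (Γ : Submodule ℤ (Euc k)) [DiscreteTopology Γ] :
    IsLocalHomeomorph (QuotientAddGroup.mk : Euc k → FlatTorus Γ) :=
  have : DiscreteTopology Γ.toAddSubgroup := ‹DiscreteTopology Γ›
  (AddSubgroup.isAddQuotientCoveringMap_of_comm Γ.toAddSubgroup
    (DiscreteTopology.isDiscrete)).isCoveringMap.isLocalHomeomorph

/-- The charts of the torus are the local inverses of the projection `ℝᵏ → ℝᵏ / Γ`. -/
instance instChartedSpaceFlatTorus (Γ : Submodule ℤ (Euc k)) [DiscreteTopology Γ] :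
    ChartedSpace (Euc k) (FlatTorus Γ) :=
  (isLocalHomeomorph_mk Γ).chartedSpace QuotientAddGroup.mk_surjective

/-- A continuous map that moves every point by an element of `Γ` is locally a translation. -/
theorem eventually_sub_eq (Γ : Submodule ℤ (Euc k)) [DiscreteTopology Γ] {f : Euc k → Euc k}
    {x : Euc k} {s : Set (Euc k)} (hs : IsOpen s) (hx : x ∈ s) (hf : ContinuousOn f s)
    (h : ∀ y ∈ s, f y - y ∈ Γ) : ∀ᶠ y in nhds x, f y = y + (f x - x) := by
  have hd : ∀ᶠ z in nhds (0 : Euc k), z ∈ Γ → z = 0 := by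
    have h0 : ({0} : Set Γ) ∈ nhds (0 : Γ) := (isOpen_discrete _).mem_nhds rfl
    rw [mem_nhds_subtype] at h0
    obtain ⟨u, hu, hu'⟩ := h0
    filter_upwards [hu] with z hz hzΓ
    exact congrArg Subtype.val (hu' (show (⟨z, hzΓ⟩ : Γ) ∈ _ from hz))
  have hc : ContinuousAt (fun y ↦ f y - y - (f x - x)) x :=
    ((hf.continuousAt (hs.mem_nhds hx)).sub continuousAt_id).sub continuousAt_const
  have ht : Filter.Tendsto (fun y ↦ f y - y - (f x - x)) (nhds x) (nhds 0) := by
    simpa [ContinuousAt] using hc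
  filter_upwards [ht.eventually hd, hs.mem_nhds hx] with y hy hys
  have := hy (Γ.sub_mem (h y hys) (h x hx))
  rw [sub_eq_zero, sub_eq_iff_eq_add] at this
  rw [this, add_comm]

/-- The transition maps between the charts are locally translations by elements of `Γ`. -/
theorem atlas_transition (Γ : Submodule ℤ (Euc k)) [DiscreteTopology Γ]
    {e e' : OpenPartialHomeomorph (FlatTorus Γ) (Euc k)} (he : e ∈ atlas (Euc k) (FlatTorus Γ))
    (he' : e' ∈ atlas (Euc k) (FlatTorus Γ)) {x : Euc k} (hx : x ∈ (e.symm.trans e').source) :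
    ∀ᶠ y in nhds x, (e.symm.trans e') y = y + ((e.symm.trans e') x - x) := by
  obtain ⟨q, rfl⟩ := he
  obtain ⟨q', rfl⟩ := he'
  refine eventually_sub_eq Γ (OpenPartialHomeomorph.open_source _) hx
    (OpenPartialHomeomorph.continuousOn _) fun y hy ↦ ?_
  simp only [chartAt_self_eq, OpenPartialHomeomorph.trans_refl,
    IsLocalHomeomorph.localInverseAt_symm, OpenPartialHomeomorph.coe_trans,
    OpenPartialHomeomorph.trans_source, Set.mem_inter_iff, Set.mem_preimage,
    Function.comp_apply] at hy ⊢
  have h2 := (isLocalHomeomorph_mk Γ).apply_localInverseAt_of_mem hy.2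
  have h3 := QuotientAddGroup.eq.1 h2.symm
  rwa [neg_add_eq_sub] at h3

instance instIsManifoldFlatTorus (Γ : Submodule ℤ (Euc k)) [DiscreteTopology Γ] :
    IsManifold 𝓘(ℝ, Euc k) ∞ (FlatTorus Γ) := by
  refine isManifold_of_contDiffOn _ _ _ fun e e' he he' ↦ ?_
  intro x hx
  have hx' : x ∈ (e.symm.trans e').source := by simpa using hx
  have h1 : ContDiffAt ℝ ∞ (fun y : Euc k ↦ y + ((e.symm.trans e') x - x)) x :=
    contDiffAt_id.add contDiffAt_const
  exact (h1.congr_of_eventuallyEq (atlas_transition Γ he he' hx')).contDiffWithinAt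

end Torus

/-! ### Hypersurfaces `F : M → T` of the flat torus

The differential of the projection `ℝⁿ⁺¹ → T` identifies every tangent space of `T` with `ℝⁿ⁺¹`.
All charts of `T` are local inverses of the projection, so this is the identification of
`TangentSpace 𝓘(ℝ, ℝⁿ⁺¹) x` with `ℝⁿ⁺¹` that Mathlib uses. The flat metric of `T` is the standard
inner product of `ℝⁿ⁺¹`, a tensor field on `T` is a function on `T` with values in the
tensors of `ℝⁿ⁺¹`, a vector field of `T` along `M` is a function `M → ℝⁿ⁺¹`, and the Levi-Civita
connection `D` of `T` is the componentwise derivative of such functions. -/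

section Hypersurface

open scoped RealInnerProductSpace
open FiberBundle VectorField

variable {n : ℕ} {Γ : Submodule ℤ (Euc (n + 1))} [DiscreteTopology Γ]
  {M : Type*} [TopologicalSpace M] [ChartedSpace (Euc n) M]

/-- The differential `dF_p : T_pM → T_{F(p)}T = ℝⁿ⁺¹`. -/
def diff (F : M → FlatTorus Γ) (p : M) : TangentSpace (𝓡 n) p →L[ℝ] Euc (n + 1) :=
  mfderiv (𝓡 n) 𝓘(ℝ, Euc (n + 1)) F p

/-- Near every point, `dF` is the differential of one and the same lift of `F` to `ℝⁿ⁺¹`. -/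
theorem diff_hasMFDerivAt (F : M → FlatTorus Γ) (hF : MDifferentiable (𝓡 n) 𝓘(ℝ, Euc (n + 1)) F)
    (p : M) : ∀ᶠ q in nhds p, HasMFDerivAt (𝓡 n) 𝓘(ℝ, Euc (n + 1))
      (fun q' ↦ chartAt (Euc (n + 1)) (F p) (F q')) q (diff F q) := by
  filter_upwards [(hF p).continuousAt.preimage_mem_nhds
    (chart_source_mem_nhds (Euc (n + 1)) (F p))] with q hq
  have hFq := (hF q).continuousAt
  have hcc : ContinuousAt (fun q' ↦ chartAt (Euc (n + 1)) (F q) (F q')) q :=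
    ContinuousAt.comp (g := chartAt (Euc (n + 1)) (F q))
      ((chartAt (Euc (n + 1)) (F q)).continuousAt (mem_chart_source _ _)) hFq
  have h0 : HasMFDerivAt (𝓡 n) 𝓘(ℝ, Euc (n + 1))
      (fun q' ↦ chartAt (Euc (n + 1)) (F q) (F q')) q (diff F q) :=
    ⟨hcc, (hF q).hasMFDerivAt.2⟩
  have hs : chartAt (Euc (n + 1)) (F q) (F q) ∈
      ((chartAt (Euc (n + 1)) (F q)).symm.trans (chartAt (Euc (n + 1)) (F p))).source := by
    simpa using hq
  have h := hcc.eventually (atlas_transition Γ (chart_mem_atlas _ (F q)) (chart_mem_atlas _ (F p)) hs)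
  set a := ((chartAt (Euc (n + 1)) (F q)).symm.trans (chartAt (Euc (n + 1)) (F p)))
      (chartAt (Euc (n + 1)) (F q) (F q)) - chartAt (Euc (n + 1)) (F q) (F q)
  have h3 : (fun q' ↦ chartAt (Euc (n + 1)) (F p) (F q')) =ᶠ[nhds q]
      (fun q' ↦ chartAt (Euc (n + 1)) (F q) (F q')) + fun _ ↦ a := by
    filter_upwards [h, hFq.preimage_mem_nhds (chart_source_mem_nhds (Euc (n + 1)) (F q))]
      with q' h1 h2
    simp only [Pi.add_apply]
    rw [← h1, OpenPartialHomeomorph.trans_apply, OpenPartialHomeomorph.left_inv _ h2]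
  have h4 := h0.add (hasMFDerivAt_const (I := 𝓡 n) (I' := 𝓘(ℝ, Euc (n + 1))) a q)
  have h5 := h4.congr_of_eventuallyEq h3
  have h6 : diff F q + (0 : TangentSpace (𝓡 n) q →L[ℝ] Euc (n + 1)) = diff F q := add_zero _
  exact h6 ▸ h5

variable [IsManifold (𝓡 n) ∞ M]

/-- The induced Riemannian metric of `M`: `g_p(v, w) = ⟨dF v, dF w⟩`. -/
def metric (F : M → FlatTorus Γ) (p : M) (v w : TangentSpace (𝓡 n) p) : ℝ :=
  ⟪diff F p v, diff F p w⟫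

/-- `e` is an orthonormal basis of `T_pM` (for an immersion `F`). -/
def IsOrthonormalFrameAt (F : M → FlatTorus Γ) (p : M) (e : Fin n → TangentSpace (𝓡 n) p) : Prop :=
  ∀ i j, metric F p (e i) (e j) = if i = j then 1 else 0

/-- The tangential part of a vector at `F p`: the vector `v ∈ T_pM` for which `dF v` is the
orthogonal projection of `x` to `dF(T_pM)` (for an immersion `F`). -/
def tangentPart (F : M → FlatTorus Γ) (p : M) : Euc (n + 1) →ₗ[ℝ] TangentSpace (𝓡 n) p :=
  (diff F p).toLinearMap.leftInverse ∘ₗ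
    (LinearMap.range (diff F p).toLinearMap).starProjection.toLinearMap

/-- An orthonormal basis of `T_pM` (for an immersion `F`, so that `dF(T_pM)` has dimension `n`). -/
def stdFrame (F : M → FlatTorus Γ) (p : M) :
    Fin (Module.finrank ℝ (LinearMap.range (diff F p).toLinearMap)) → TangentSpace (𝓡 n) p :=
  fun i ↦ tangentPart F p
    (stdOrthonormalBasis ℝ (LinearMap.range (diff F p).toLinearMap) i : Euc (n + 1))

/-- The trace of a bilinear form on `T_pM` with respect to the induced metric. -/
def trace (F : M → FlatTorus Γ) (p : M)
    (B : TangentSpace (𝓡 n) p → TangentSpace (𝓡 n) p → ℝ) : ℝ :=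
  ∑ i, B (stdFrame F p i) (stdFrame F p i)

/-- `N` is a smooth unit normal vector field along the hypersurface. -/
structure IsUnitNormal (F : M → FlatTorus Γ) (N : M → Euc (n + 1)) : Prop where
  contMDiff : ContMDiff (𝓡 n) 𝓘(ℝ, Euc (n + 1)) ∞ N
  norm_eq_one : ∀ p, ‖N p‖ = 1
  inner_eq_zero : ∀ p (v : TangentSpace (𝓡 n) p), ⟪diff F p v, N p⟫ = 0

/-- The derivative `D_v (dF ∘ Y) ∈ T_{F(p)}T` for `v ∈ T_pM` and a vector field `Y` on `M`. -/
def ambientDeriv (F : M → FlatTorus Γ) (Y : ∀ q : M, TangentSpace (𝓡 n) q) (p : M)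
    (v : TangentSpace (𝓡 n) p) : Euc (n + 1) :=
  mvfderiv (𝓡 n) (fun q ↦ diff F q (Y q)) p v

/-- The second fundamental form `A(v, w) = ⟨D_v W, N⟩`, for any vector field `W` with
`W p = w`. -/
def secondFF (F : M → FlatTorus Γ) (N : M → Euc (n + 1)) (p : M)
    (v w : TangentSpace (𝓡 n) p) : ℝ :=
  ⟪ambientDeriv F (extend (Euc n) w) p v, N p⟫

/-- The squared norm `|A|²` of the second fundamental form. -/
def secondFFNormSq (F : M → FlatTorus Γ) (N : M → Euc (n + 1)) (p : M) : ℝ :=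
  ∑ i, ∑ j, secondFF F N p (stdFrame F p i) (stdFrame F p j) ^ 2

/-- The mean curvature vanishes. -/
def IsMinimal (F : M → FlatTorus Γ) (N : M → Euc (n + 1)) : Prop :=
  ∀ p, trace F p (secondFF F N p) = 0

/-! ### The induced connection, exterior derivative and Laplacians on `M` -/

/-- The induced Levi-Civita connection `∇_v Y` of `M`, the tangential part of `D_v Y`. -/
def nabla (F : M → FlatTorus Γ) (Y : ∀ q : M, TangentSpace (𝓡 n) q) (p : M)
    (v : TangentSpace (𝓡 n) p) : TangentSpace (𝓡 n) p :=
  tangentPart F p (ambientDeriv F Y p v)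

/-- The covariant derivative of a `1`-form, `(∇_v ω₁)(w) = v(ω₁(W)) - ω₁(∇_v W)` for any vector
field `W` with `W p = w`. -/
def nablaOneForm (F : M → FlatTorus Γ) (ω₁ : ∀ q : M, TangentSpace (𝓡 n) q →L[ℝ] ℝ) (p : M)
    (v w : TangentSpace (𝓡 n) p) : ℝ :=
  mvfderiv (𝓡 n) (fun q ↦ ω₁ q (extend (Euc n) w q)) p v
    - ω₁ p (nabla F (extend (Euc n) w) p v)

/-- The covariant derivative of a `2`-tensor,
`(∇_v η)(w, z) = v(η(W, Z)) - η(∇_v W, z) - η(w, ∇_v Z)` for any vector fields `W`, `Z` with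
`W p = w` and `Z p = z`. -/
def nablaTwoTensor (F : M → FlatTorus Γ)
    (η : ∀ q : M, TangentSpace (𝓡 n) q → TangentSpace (𝓡 n) q → ℝ) (p : M)
    (v w z : TangentSpace (𝓡 n) p) : ℝ :=
  mvfderiv (𝓡 n) (fun q ↦ η q (extend (Euc n) w q) (extend (Euc n) z q)) p v
    - η p (nabla F (extend (Euc n) w) p v) z
    - η p w (nabla F (extend (Euc n) z) p v)

/-- The exterior derivative of a `1`-form, `dω₁(v, w) = v(ω₁(W)) - w(ω₁(V)) - ω₁([V, W])` for any
vector fields `V`, `W` with `V p = v` and `W p = w`. -/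
def extDerivOneForm (ω₁ : ∀ q : M, TangentSpace (𝓡 n) q →L[ℝ] ℝ) (p : M)
    (v w : TangentSpace (𝓡 n) p) : ℝ :=
  mvfderiv (𝓡 n) (fun q ↦ ω₁ q (extend (Euc n) w q)) p v
    - mvfderiv (𝓡 n) (fun q ↦ ω₁ q (extend (Euc n) v q)) p w
    - ω₁ p (mlieBracket (𝓡 n) (extend (Euc n) v) (extend (Euc n) w) p)

/-- The codifferential of a `1`-form, `d*ω₁ = - ∑ i, (∇_{E_i} ω₁)(E_i)`. -/
def codiffOneForm (F : M → FlatTorus Γ) (ω₁ : ∀ q : M, TangentSpace (𝓡 n) q →L[ℝ] ℝ) (p : M) : ℝ :=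
  -trace F p (nablaOneForm F ω₁ p)

/-- The codifferential of a `2`-form, `(d*η)(z) = - ∑ i, (∇_{E_i} η)(E_i, z)`. -/
def codiffTwoForm (F : M → FlatTorus Γ)
    (η : ∀ q : M, TangentSpace (𝓡 n) q → TangentSpace (𝓡 n) q → ℝ) (p : M)
    (z : TangentSpace (𝓡 n) p) : ℝ :=
  -trace F p fun v w ↦ nablaTwoTensor F η p v w z

/-- The Hodge Laplacian `Δ₁ω₁ = d(d*ω₁) + d*(dω₁)` of a `1`-form. -/
def hodgeLaplacian (F : M → FlatTorus Γ) (ω₁ : ∀ q : M, TangentSpace (𝓡 n) q →L[ℝ] ℝ) (p : M)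
    (z : TangentSpace (𝓡 n) p) : ℝ :=
  mvfderiv (𝓡 n) (codiffOneForm F ω₁) p z + codiffTwoForm F (extDerivOneForm ω₁) p z

/-- `ω₁` is a smooth section of the cotangent bundle of `M`. -/
def IsSmoothOneForm (ω₁ : ∀ q : M, TangentSpace (𝓡 n) q →L[ℝ] ℝ) : Prop :=
  ContMDiff (𝓡 n) ((𝓡 n).prod 𝓘(ℝ, Euc n →L[ℝ] ℝ)) ∞
    (fun q ↦ Bundle.TotalSpace.mk' (Euc n →L[ℝ] ℝ)
      (E := fun q : M ↦ TangentSpace (𝓡 n) q →L[ℝ] Bundle.Trivial M ℝ q) q (ω₁ q))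

/-- `ω₁` is a harmonic `1`-form. -/
structure IsHarmonicOneForm (F : M → FlatTorus Γ)
    (ω₁ : ∀ q : M, TangentSpace (𝓡 n) q →L[ℝ] ℝ) : Prop where
  smooth : IsSmoothOneForm ω₁
  hodgeLaplacian_eq_zero : ∀ p z, hodgeLaplacian F ω₁ p z = 0

/-- The Laplace-Beltrami operator `Δu = tr ∇du` of `M`. -/
def laplacian (F : M → FlatTorus Γ) (u : M → ℝ) (p : M) : ℝ :=
  trace F p (nablaOneForm F (mvfderiv (𝓡 n) u) p)

/-! ### `2`-forms of the torus along `M` -/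

/-- The smooth `2`-form `θ` on the torus is parallel: `Dθ = 0`. -/
structure IsParallelTwoForm (θ : FlatTorus Γ → Euc (n + 1) [⋀^Fin 2]→L[ℝ] ℝ) : Prop where
  contMDiff : ContMDiff 𝓘(ℝ, Euc (n + 1)) 𝓘(ℝ, Euc (n + 1) [⋀^Fin 2]→L[ℝ] ℝ) ∞ θ
  deriv_eq_zero : ∀ x, mvfderiv 𝓘(ℝ, Euc (n + 1)) θ x = 0

/-- The covector `x^♭ = ⟨x, ·⟩`. -/
def flat (x : Euc (n + 1)) : Euc (n + 1) → ℝ := fun y ↦ ⟪x, y⟫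

/-- A covector `α` of `M` at `p` as a covector of the torus at `F p`, vanishing on the normal. -/
def ambientCovector (F : M → FlatTorus Γ) (p : M) (α : TangentSpace (𝓡 n) p → ℝ) :
    Euc (n + 1) → ℝ :=
  fun y ↦ α (tangentPart F p y)

/-- The exterior product of two covectors, `(α ∧ β)(x, y) = α(x) β(y) - α(y) β(x)`. -/
def wedge (α β : Euc (n + 1) → ℝ) : Euc (n + 1) → Euc (n + 1) → ℝ :=
  fun x y ↦ α x * β y - α y * β x

/-- The inner product of `2`-forms on `ℝⁿ⁺¹` for which the `ε_a^♭ ∧ ε_b^♭`, `a < b`, are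
orthonormal, where `ε` is the standard basis. -/
def innerTwoForm (η : Euc (n + 1) → Euc (n + 1) → ℝ) (θ : Euc (n + 1) [⋀^Fin 2]→L[ℝ] ℝ) : ℝ :=
  ∑ a : Fin (n + 1), ∑ b ∈ Finset.Ioi a,
    η (EuclideanSpace.single a 1) (EuclideanSpace.single b 1) *
      θ ![EuclideanSpace.single a 1, EuclideanSpace.single b 1]

/-- The function `⟨N^♭ ∧ ω₁, θ⟩` on `M`. -/
def testFunction (F : M → FlatTorus Γ) (N : M → Euc (n + 1))
    (ω₁ : ∀ q : M, TangentSpace (𝓡 n) q →L[ℝ] ℝ)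
    (θ : FlatTorus Γ → Euc (n + 1) [⋀^Fin 2]→L[ℝ] ℝ) (p : M) : ℝ :=
  innerTwoForm (wedge (flat (N p)) (ambientCovector F p (ω₁ p))) (θ (F p))

/-- The sum `∑ i, ∑ j, A(E_i, E_j) ⟨E_j^♭ ∧ ∇_{E_i} ω₁, θ⟩` at `p`. -/
def crossTerm (F : M → FlatTorus Γ) (N : M → Euc (n + 1))
    (ω₁ : ∀ q : M, TangentSpace (𝓡 n) q →L[ℝ] ℝ)
    (θ : FlatTorus Γ → Euc (n + 1) [⋀^Fin 2]→L[ℝ] ℝ) (p : M)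
    (e : Fin n → TangentSpace (𝓡 n) p) : ℝ :=
  ∑ i, ∑ j, secondFF F N p (e i) (e j) *
    innerTwoForm (wedge (flat (diff F p (e j)))
      (ambientCovector F p (nablaOneForm F ω₁ p (e i)))) (θ (F p))

end Hypersurface

end TorusHypersurface

end

/-!
The proof uses the calculus of tangential derivatives, which avoids local frames. Let `ε_a` be the
standard basis of `ℝⁿ⁺¹`, let `T_a` be the tangential part of `ε_a` (`coordField`), and let
`δ_a f = df(T_a)` (`tangDeriv`). The `n + 1` fields `T_a` are globally defined and smooth
(`contMDiff_coordField`), and for every orthonormal basis `e` of a tangent space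
`∑ i, (dF e_i)_a e_i = T_a`, so that traces over `e` become sums over ambient indices
(`IsParsevalFrame`, `trace_sum_mul`, `sum_frame_frame`). This also makes the right-hand side
independent of the frame (`crossTerm_eq`).

Writing `N_a` for the components of the normal, `Z_a = ω₁(T_a)` and `t_ab = θ(ε_a, ε_b)`, every
quantity of the theorem is a polynomial in `N`, `Z`, `t` and their tangential derivatives:
`Δf = ∑ δ_a δ_a f`, `|A|² = ∑ (δ_a N_c)²`, `u = ∑ t_ab N_a Z_b`, and similarly for the Hodge
Laplacian (`harmonic_eq`). The geometry enters only through

* `δ_a N_b = δ_b N_a`, the symmetry of `A` (`tangDeriv_normalCoord_comm`),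
* `[δ_a, δ_b] = ∑ c, (N_a δ_b N_c - N_b δ_a N_c) δ_c` (`tangDeriv_comm`),
* `∑ a, N_a δ_a = 0`, `∑ a, N_a Z_a = 0`, and `∑ a, δ_a N_a = 0`, which is minimality,
* `δ_c t_ab = 0` and `t_ab = -t_ba`, as `θ` is a parallel two-form.

The rest is algebra in the ring of smooth functions. Commuting derivatives gives
`ΔN_b = -|A|² N_b` (`sum_deriv_deriv_normal`) and, for harmonic `ω₁`, the Bochner formula
`ΔZ_b = -2 ∑ c, δ_b N_c s_c + N_b L` with `s_c = ∑ d, Z_d δ_c N_d` (`sum_deriv_deriv_harmonic`).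
In `Δu = ∑ t_ab (ΔN_a Z_b + 2 ∑ k, δ_k N_a δ_k Z_b + N_a ΔZ_b)` the first summand is `-|A|² u`. The
vector `δ_k Z` has the tangential part `∇_k ω₁` and the normal part `-s_k N`. The normal part
contributes `-2 N_b ∑ k, δ_a N_k s_k` to the second summand, which together with
`N_a ΔZ_b` is symmetric in `a` and `b` and cancels against the antisymmetry of `t`
(`sum_deriv_deriv_test`). What remains is the right-hand side, as `A` is `-dN`.
-/

noncomputable section

namespace TorusHypersurface

/-! ### Smooth vector fields as derivations -/

section Calculus

open Bundle VectorField

variable {n : ℕ} {M : Type*} [TopologicalSpace M] [ChartedSpace (Euc n) M]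
  [IsManifold (𝓡 n) ∞ M] {V : Type*} [NormedAddCommGroup V] [NormedSpace ℝ V]

/-- The derivative of a smooth function along a smooth vector field is smooth. -/
theorem contMDiffAt_mvfderiv_apply {f : M → V} {Y : ∀ q : M, TangentSpace (𝓡 n) q} {p : M}
    (hf : ContMDiffAt (𝓡 n) 𝓘(ℝ, V) ∞ f p)
    (hY : ContMDiffAt (𝓡 n) (𝓡 n).tangent ∞ (fun q ↦ (Y q : TangentBundle (𝓡 n) M)) p) :
    ContMDiffAt (𝓡 n) 𝓘(ℝ, V) ∞ (fun q ↦ mvfderiv (𝓡 n) f q (Y q)) p := by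
  have h1 := (hf.mfderiv_const (m := ∞) le_rfl)
  have h2 : ContMDiffAt (𝓡 n) 𝓘(ℝ, V).tangent ∞
      (fun q ↦ (mfderiv (𝓡 n) 𝓘(ℝ, V) f q (Y q) : TangentBundle 𝓘(ℝ, V) V)) p :=
    ContMDiffAt.clm_apply_of_inCoordinates (b₁ := id) (b₂ := f) h1 hY hf
  exact (contMDiff_snd_tangentBundle_modelSpace V 𝓘(ℝ, V)).contMDiffAt.comp p h2

/-- The Lie bracket of vector fields is the commutator of the derivations they define. -/
theorem mvfderiv_mlieBracket {f : M → V} {X Y : ∀ q : M, TangentSpace (𝓡 n) q} {p : M}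
    (hf : ContMDiffAt (𝓡 n) 𝓘(ℝ, V) ∞ f p)
    (hX : ContMDiffAt (𝓡 n) (𝓡 n).tangent ∞ (fun q ↦ (X q : TangentBundle (𝓡 n) M)) p)
    (hY : ContMDiffAt (𝓡 n) (𝓡 n).tangent ∞ (fun q ↦ (Y q : TangentBundle (𝓡 n) M)) p) :
    mvfderiv (𝓡 n) f p (mlieBracket (𝓡 n) X Y p) =
      mvfderiv (𝓡 n) (fun q ↦ mvfderiv (𝓡 n) f q (Y q)) p (X p)
        - mvfderiv (𝓡 n) (fun q ↦ mvfderiv (𝓡 n) f q (X q)) p (Y p) := by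
  set φ := extChartAt (𝓡 n) p with hφ
  let pull : (∀ q : M, TangentSpace (𝓡 n) q) → Euc n → Euc n := fun Z ↦
    mpullbackWithin 𝓘(ℝ, Euc n) (𝓡 n) φ.symm Z (Set.range (𝓡 n))
  have hp : φ.symm (φ p) = p := extChartAt_to_inv p
  have htarget : φ.target ∈ nhds (φ p) := extChartAt_target_mem_nhds p
  have htend : Filter.Tendsto φ.symm (nhds (φ p)) (nhds p) := by
    have := continuousAt_extChartAt_symm (I := 𝓡 n) p
    rwa [ContinuousAt, ← hφ, hp] at this
  -- in the chart at `p`, `dg(Z)` becomes the derivative of `g ∘ φ⁻¹` along the pulled back field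
  have key : ∀ g : M → V, ContMDiffAt (𝓡 n) 𝓘(ℝ, V) ∞ g p → ∀ Z : ∀ q : M, TangentSpace (𝓡 n) q,
    ∀ᶠ y in nhds (φ p), mvfderiv (𝓡 n) g (φ.symm y) (Z (φ.symm y)) =
      fderiv ℝ (g ∘ φ.symm) y (pull Z y) := by
    intro g hg Z
    have hg1 : ∀ᶠ q in nhds p, ContMDiffAt (𝓡 n) 𝓘(ℝ, V) 1 g q :=
      (contMDiffAt_iff_contMDiffAt_nhds (by simp)).1
        (ContMDiffAt.of_le hg (by exact_mod_cast (le_top (a := (1 : ℕ∞)))))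
    filter_upwards [htarget, htend.eventually hg1] with y hy hgy
    have h1 : MDifferentiableAt (𝓡 n) 𝓘(ℝ, V) g (φ.symm y) := hgy.mdifferentiableAt one_ne_zero
    have h2 : MDifferentiableAt 𝓘(ℝ, Euc n) (𝓡 n) φ.symm y := by
      have := mdifferentiableWithinAt_extChartAt_symm (I := 𝓡 n) hy
      rwa [ModelWithCorners.range_eq_univ, mdifferentiableWithinAt_univ] at this
    have h3 : mfderiv 𝓘(ℝ, Euc n) 𝓘(ℝ, V) (g ∘ φ.symm) y =
      (mfderiv (𝓡 n) 𝓘(ℝ, V) g (φ.symm y)).comp (mfderiv 𝓘(ℝ, Euc n) (𝓡 n) φ.symm y) :=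
      mfderiv_comp y h1 h2
    have hinv := isInvertible_mfderivWithin_extChartAt_symm (I := 𝓡 n) hy
    rw [ModelWithCorners.range_eq_univ, mfderivWithin_univ] at hinv
    have h4 : pull Z y = (mfderiv 𝓘(ℝ, Euc n) (𝓡 n) φ.symm y).inverse (Z (φ.symm y)) := by
      rw [← mfderivWithin_univ, ← ModelWithCorners.range_eq_univ (𝓡 n)]
      rfl
    have h5 : (mfderiv 𝓘(ℝ, Euc n) (𝓡 n) φ.symm y) (pull Z y) = Z (φ.symm y) := by
      rw [h4]; exact hinv.self_apply_inverse _
    rw [← mfderiv_eq_fderiv]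
    exact (congrArg (mvfderiv (𝓡 n) g (φ.symm y)) h5.symm).trans
      (DFunLike.congr_fun h3 (pull Z y)).symm
  have key0 : ∀ g : M → V, ContMDiffAt (𝓡 n) 𝓘(ℝ, V) ∞ g p → ∀ Z : ∀ q : M, TangentSpace (𝓡 n) q,
      mvfderiv (𝓡 n) g p (Z p) = fderiv ℝ (g ∘ φ.symm) (φ p) (pull Z (φ p)) := by
    intro g hg Z
    have := (key g hg Z).self_of_nhds
    rwa [hp] at this
  have hset : φ.symm ⁻¹' Set.univ ∩ Set.range (𝓡 n) = Set.univ := by simp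
  have hdiff : ∀ Z : ∀ q : M, TangentSpace (𝓡 n) q,
      ContMDiffAt (𝓡 n) (𝓡 n).tangent ∞ (fun q ↦ (Z q : TangentBundle (𝓡 n) M)) p →
      DifferentiableAt ℝ (pull Z) (φ p) := by
    intro Z hZ
    have h1 := (hZ.mdifferentiableAt (by simp)).mdifferentiableWithinAt (s := Set.univ)
    have h2 : DifferentiableWithinAt ℝ (pull Z) (φ.symm ⁻¹' Set.univ ∩ Set.range (𝓡 n)) (φ p) :=
      h1.differentiableWithinAt_mpullbackWithin_vectorField
    rwa [hset, differentiableWithinAt_univ] at h2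
  have hsec : ∀ Z : ∀ q : M, TangentSpace (𝓡 n) q,
      ContMDiffAt (𝓡 n) (𝓡 n).tangent ∞ (fun q ↦ (Z q : TangentBundle (𝓡 n) M)) p →
      ∀ W : ∀ q : M, TangentSpace (𝓡 n) q,
      mvfderiv (𝓡 n) (fun q ↦ mvfderiv (𝓡 n) f q (Z q)) p (W p) =
        fderiv ℝ (fun y ↦ fderiv ℝ (f ∘ φ.symm) y (pull Z y)) (φ p) (pull W (φ p)) := by
    intro Z hZ W
    rw [key0 _ (contMDiffAt_mvfderiv_apply hf hZ) W]
    have : ((fun q ↦ mvfderiv (𝓡 n) f q (Z q)) ∘ φ.symm) =ᶠ[nhds (φ p)]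
        fun y ↦ fderiv ℝ (f ∘ φ.symm) y (pull Z y) := key f hf Z
    rw [this.fderiv_eq]
  have hfc : ContDiffAt ℝ 2 (f ∘ φ.symm) (φ p) := by
    have h1 : ContMDiffAt 𝓘(ℝ, Euc n) (𝓡 n) ∞ φ.symm (φ p) :=
      (contMDiffOn_extChartAt_symm p).contMDiffAt htarget
    have h2 : ContMDiffAt 𝓘(ℝ, Euc n) 𝓘(ℝ, V) ∞ (f ∘ φ.symm) (φ p) :=
      ContMDiffAt.comp (φ p) (by rwa [hp]) h1
    exact h2.contDiffAt.of_le ENat.LEInfty.out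
  have hpull : ∀ Z : ∀ q : M, TangentSpace (𝓡 n) q, pull Z (φ p) = (Z p : Euc n) := fun Z ↦
    (mfderivWithin_extChartAt_symm_inverse_apply (I := 𝓡 n) (x := p) (Z (φ.symm (φ p)))).trans
      (congrArg (fun q ↦ (Z q : Euc n)) hp)
  -- the differential of the chart at its own base point is the identity
  have hb : (mlieBracket (𝓡 n) X Y p : Euc n) =
      lieBracket ℝ (pull X) (pull Y) (φ p) := by
    have h1 : mlieBracket (𝓡 n) X Y p = (mfderiv (𝓡 n) 𝓘(ℝ, Euc n) (extChartAt (𝓡 n) p) p).inverse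
        (lieBracketWithin ℝ (pull X) (pull Y) (φ.symm ⁻¹' Set.univ ∩ Set.range (𝓡 n)) (φ p)) := rfl
    have h0 : lieBracketWithin ℝ (pull X) (pull Y) (φ.symm ⁻¹' Set.univ ∩ Set.range (𝓡 n)) (φ p) =
        lieBracket ℝ (pull X) (pull Y) (φ p) := by rw [hset, lieBracketWithin_univ]
    have h2 : ∀ w : Euc n,
        ((mfderiv (𝓡 n) 𝓘(ℝ, Euc n) (extChartAt (𝓡 n) p) p).inverse w : Euc n) = w := by
      intro w
      rw [mfderiv_extChartAt_self]
      exact DFunLike.congr_fun (ContinuousLinearMap.inverse_id (R := ℝ) (M := Euc n)) w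
    exact h1.trans ((h2 _).trans h0)
  rw [hsec Y hY X, hsec X hX Y, ← VectorField.fderiv_apply_lieBracket hfc (by simp) (hdiff Y hY)
    (hdiff X hX), key0 f hf, hpull, hb]

end Calculus

/-! ### Tangential and normal parts -/

section Immersion

open scoped RealInnerProductSpace
open FiberBundle VectorField

variable {n : ℕ} {Γ : Submodule ℤ (Euc (n + 1))} [DiscreteTopology Γ]
  {M : Type*} [TopologicalSpace M] [ChartedSpace (Euc n) M]
  {F : M → FlatTorus Γ} {N : M → Euc (n + 1)}

/-- The immersions of Mathlib are given by a normal form in charts, `x ↦ (x, 0)`. Projecting back to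
the first factor yields a differentiable local left inverse, so the differential is injective. -/
theorem injective_diff (hF : Manifold.IsImmersion (𝓡 n) 𝓘(ℝ, Euc (n + 1)) ∞ F) (p : M) :
    Function.Injective (diff F p) := by
  have h := hF.isImmersionAt p
  let φ := h.domChart
  let ψ := h.codChart
  have hp : p ∈ φ.source := h.mem_domChart_source
  have hFp : F p ∈ ψ.source := h.mem_codChart_source
  -- the local left inverse of `F` given by the charts in which `F` is a linear inclusion
  let g : FlatTorus Γ → M := fun x ↦ φ.symm (h.equiv.symm (ψ x)).1
  have hval : ∀ q ∈ φ.source, (h.equiv.symm (ψ (F q))).1 = φ q := by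
    intro q hq
    have h1 := h.writtenInCharts (φ.extend (𝓡 n) |>.map_source (by simpa using hq))
    have h2 : ψ (F q) = h.equiv (φ q, 0) := by
      have h3 : (φ.extend (𝓡 n)).symm (φ.extend (𝓡 n) q) = q := φ.extend_left_inv hq
      exact (congrArg (fun x ↦ (ψ.extend 𝓘(ℝ, Euc (n + 1))) (F x)) h3).symm.trans h1
    rw [h2, ContinuousLinearEquiv.symm_apply_apply]
  have hgF : (g ∘ F) =ᶠ[nhds p] id := by
    filter_upwards [φ.open_source.mem_nhds hp] with q hq
    simp only [g, Function.comp_apply, id, hval q hq]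
    exact φ.left_inv hq
  have hg : MDifferentiableAt 𝓘(ℝ, Euc (n + 1)) (𝓡 n) g (F p) := by
    have h1 : MDifferentiableAt 𝓘(ℝ, Euc (n + 1)) 𝓘(ℝ, Euc (n + 1)) ψ (F p) :=
      (contMDiffAt_of_mem_maximalAtlas h.codChart_mem_maximalAtlas hFp).mdifferentiableAt
        (by simp)
    have h2 : MDifferentiableAt 𝓘(ℝ, Euc (n + 1)) (𝓡 n)
        (fun y : Euc (n + 1) ↦ (h.equiv.symm y).1) (ψ (F p)) := by
      refine DifferentiableAt.mdifferentiableAt ?_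
      exact (h.equiv.symm.differentiableAt).fst
    have h3 : MDifferentiableAt (𝓡 n) (𝓡 n) φ.symm ((h.equiv.symm (ψ (F p))).1) := by
      rw [hval p hp]
      exact (contMDiffAt_symm_of_mem_maximalAtlas h.domChart_mem_maximalAtlas
        (φ.map_source hp)).mdifferentiableAt (by simp)
    exact MDifferentiableAt.comp (g := φ.symm) (f := fun x ↦ (h.equiv.symm (ψ x)).1) (F p) h3
      (MDifferentiableAt.comp (g := fun y : Euc (n + 1) ↦ (h.equiv.symm y).1) (F p) h2 h1)
  have hFd : MDifferentiableAt (𝓡 n) 𝓘(ℝ, Euc (n + 1)) F p :=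
    (hF.contMDiff p).mdifferentiableAt (by simp)
  have hcomp := mfderiv_comp p hg hFd
  rw [hgF.mfderiv_eq, mfderiv_id] at hcomp
  intro v w hvw
  have h1 := DFunLike.congr_fun hcomp v
  have h2 := DFunLike.congr_fun hcomp w
  have h3 : mfderiv (𝓡 n) 𝓘(ℝ, Euc (n + 1)) F p v = mfderiv (𝓡 n) 𝓘(ℝ, Euc (n + 1)) F p w := hvw
  exact h1.trans ((congrArg _ h3).trans h2.symm)

theorem tangentPart_diff (hF : ∀ p, Function.Injective (diff F p)) (p : M)
    (v : TangentSpace (𝓡 n) p) : tangentPart F p (diff F p v) = v := by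
  have h1 : (LinearMap.range (diff F p).toLinearMap).starProjection (diff F p v) = diff F p v :=
    Submodule.starProjection_eq_self_iff.2 ⟨v, rfl⟩
  have h2 := LinearMap.leftInverse_apply_of_inj (f := (diff F p).toLinearMap)
    (LinearMap.ker_eq_bot.2 (hF p)) v
  simp only [tangentPart, LinearMap.comp_apply]
  exact (congrArg _ h1).trans h2

/-- The tangent space `dF(T_pM)` is the orthogonal complement of `N p`, by a dimension count. -/
theorem range_diff (hF : ∀ p, Function.Injective (diff F p)) (hN : IsUnitNormal F N) (p : M) :
    LinearMap.range (diff F p).toLinearMap = (ℝ ∙ N p)ᗮ := by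
  have hne : N p ≠ 0 := fun h ↦ by simpa [h] using hN.norm_eq_one p
  have : Fact (Module.finrank ℝ (Euc (n + 1)) = n + 1) := ⟨by simp⟩
  have h1 : Module.finrank ℝ (LinearMap.range (diff F p).toLinearMap) = n := by
    rw [LinearMap.finrank_range_of_inj (hF p)]
    exact finrank_euclideanSpace_fin
  refine Submodule.eq_of_le_of_finrank_eq ?_ ?_
  · rintro _ ⟨v, rfl⟩
    rw [Submodule.mem_orthogonal_singleton_iff_inner_left]
    exact hN.inner_eq_zero p v
  · rw [h1, Submodule.finrank_orthogonal_span_singleton (n := n) hne]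

theorem diff_tangentPart (hF : ∀ p, Function.Injective (diff F p)) (hN : IsUnitNormal F N) (p : M)
    (x : Euc (n + 1)) : diff F p (tangentPart F p x) = x - ⟪x, N p⟫ • N p := by
  have hNN : ⟪N p, N p⟫ = 1 := by rw [real_inner_self_eq_norm_sq, hN.norm_eq_one p]; norm_num
  have h1 : (LinearMap.range (diff F p).toLinearMap).starProjection x = x - ⟪x, N p⟫ • N p := by
    refine (Submodule.eq_starProjection_of_mem_of_inner_eq_zero ?_ ?_)
    · rw [range_diff hF hN, Submodule.mem_orthogonal_singleton_iff_inner_left]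
      rw [inner_sub_left, real_inner_smul_left, hNN, mul_one, sub_self]
    · intro w hw
      rw [range_diff hF hN, Submodule.mem_orthogonal_singleton_iff_inner_left] at hw
      rw [sub_sub_cancel, real_inner_smul_left, real_inner_comm w, hw, mul_zero]
  obtain ⟨v, hv⟩ : x - ⟪x, N p⟫ • N p ∈ LinearMap.range (diff F p).toLinearMap := by
    rw [← h1]; exact Submodule.starProjection_apply_mem _ _
  have h2 : tangentPart F p x = v := by
    have h3 : tangentPart F p x = tangentPart F p (diff F p v) := by
      simp only [tangentPart, LinearMap.comp_apply]
      refine congrArg _ ?_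
      refine h1.trans (hv.symm.trans ?_)
      exact (Submodule.starProjection_eq_self_iff.2 (LinearMap.mem_range_self _ v)).symm
    rw [h3, tangentPart_diff hF]
  rw [h2]; exact hv

end Immersion

/-! ### The tangential parts of the coordinate fields -/

section Fields

open scoped RealInnerProductSpace
open FiberBundle VectorField

variable {n : ℕ} {Γ : Submodule ℤ (Euc (n + 1))} [DiscreteTopology Γ]
  {M : Type*} [TopologicalSpace M] [ChartedSpace (Euc n) M]
  {F : M → FlatTorus Γ} {N : M → Euc (n + 1)}

/-- Near every point `F` lifts to a smooth map to Euclidean space with the same differential. -/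
theorem exists_local_lift (hF : ContMDiff (𝓡 n) 𝓘(ℝ, Euc (n + 1)) ∞ F) (p : M) :
    ∃ f : M → Euc (n + 1), ContMDiffAt (𝓡 n) 𝓘(ℝ, Euc (n + 1)) ∞ f p ∧
      ∀ᶠ q in nhds p, ∀ v, diff F q v = mvfderiv (𝓡 n) f q v := by
  refine ⟨fun q ↦ chartAt (Euc (n + 1)) (F p) (F q), ?_, ?_⟩
  · exact ContMDiffAt.comp p (contMDiffAt_of_mem_maximalAtlas
      (IsManifold.chart_mem_maximalAtlas (F p)) (mem_chart_source _ _)) (hF p)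
  · filter_upwards [diff_hasMFDerivAt F (hF.mdifferentiable (by simp)) p] with q hq v
    exact (DFunLike.congr_fun hq.mfderiv v).symm

/-- The tangential part `T_a` of the constant vector field `ε_a` of the torus. These `n + 1` global
fields take the place of a local frame: they span every tangent space of `M`, and they satisfy
`dF(T_a) = ε_a - N_a N`. -/
def coordField (F : M → FlatTorus Γ) (a : Fin (n + 1)) (q : M) : TangentSpace (𝓡 n) q :=
  tangentPart F q (EuclideanSpace.single a 1)

theorem tangentPart_eq_sum (F : M → FlatTorus Γ) (q : M) (x : Euc (n + 1)) :
    tangentPart F q x = ∑ a, x a • coordField F a q := by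
  have h : x = ∑ a, x a • EuclideanSpace.single a (1 : ℝ) := by
    simpa using ((EuclideanSpace.basisFun (Fin (n + 1)) ℝ).sum_repr x).symm
  conv_lhs => rw [h]
  simp only [map_sum, map_smul, coordField]

theorem eq_sum_coordField (hF : ∀ p, Function.Injective (diff F p)) (q : M)
    (v : TangentSpace (𝓡 n) q) : v = ∑ a, diff F q v a • coordField F a q := by
  rw [← tangentPart_eq_sum, tangentPart_diff hF]

theorem diff_coordField (hF : ∀ p, Function.Injective (diff F p)) (hN : IsUnitNormal F N)
    (a b : Fin (n + 1)) (q : M) :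
    diff F q (coordField F a q) b = (if a = b then 1 else 0) - N q a * N q b := by
  rw [coordField, diff_tangentPart hF hN]
  simp [EuclideanSpace.inner_single_left, eq_comm]

theorem tangentPart_normal (hF : ∀ p, Function.Injective (diff F p)) (hN : IsUnitNormal F N)
    (q : M) : tangentPart F q (N q) = 0 := by
  apply hF q
  rw [diff_tangentPart hF hN, map_zero, real_inner_self_eq_norm_sq, hN.norm_eq_one]
  simp

variable [IsManifold (𝓡 n) ∞ M]

theorem contMDiffAt_diff_apply (hF : ContMDiff (𝓡 n) 𝓘(ℝ, Euc (n + 1)) ∞ F)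
    {Y : ∀ q : M, TangentSpace (𝓡 n) q} {p : M}
    (hY : ContMDiffAt (𝓡 n) (𝓡 n).tangent ∞ (fun q ↦ (Y q : TangentBundle (𝓡 n) M)) p) :
    ContMDiffAt (𝓡 n) 𝓘(ℝ, Euc (n + 1)) ∞ (fun q ↦ diff F q (Y q)) p := by
  obtain ⟨f, hf, hfF⟩ := exists_local_lift hF p
  refine (contMDiffAt_mvfderiv_apply hf hY).congr_of_eventuallyEq ?_
  filter_upwards [hfF] with q hq using hq _

/-- The flat connection `D` along `M` is torsion free: `dF([X, Y]) = D_X(dF Y) - D_Y(dF X)`. -/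
theorem diff_mlieBracket (hF : ContMDiff (𝓡 n) 𝓘(ℝ, Euc (n + 1)) ∞ F)
    {X Y : ∀ q : M, TangentSpace (𝓡 n) q} {p : M}
    (hX : ContMDiffAt (𝓡 n) (𝓡 n).tangent ∞ (fun q ↦ (X q : TangentBundle (𝓡 n) M)) p)
    (hY : ContMDiffAt (𝓡 n) (𝓡 n).tangent ∞ (fun q ↦ (Y q : TangentBundle (𝓡 n) M)) p) :
    diff F p (mlieBracket (𝓡 n) X Y p) = ambientDeriv F Y p (X p) - ambientDeriv F X p (Y p) := by
  obtain ⟨f, hf, hfF⟩ := exists_local_lift hF p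
  have h : ∀ Z : ∀ q : M, TangentSpace (𝓡 n) q,
      mvfderiv (𝓡 n) (fun q ↦ diff F q (Z q)) p =
        mvfderiv (𝓡 n) (fun q ↦ mvfderiv (𝓡 n) f q (Z q)) p := by
    intro Z
    have : (fun q ↦ diff F q (Z q)) =ᶠ[nhds p] fun q ↦ mvfderiv (𝓡 n) f q (Z q) := by
      filter_upwards [hfF] with q hq using hq _
    unfold mvfderiv
    rw [this.mfderiv_eq]
    rfl
  rw [hfF.self_of_nhds, mvfderiv_mlieBracket hf hX hY]
  simp only [ambientDeriv, h]

/-- The definition of the tangential part involves a choice of a left inverse at every point.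
Smoothness of `T_a` holds since `(v, t) ↦ dF v + t N` is an isomorphism that depends smoothly on the
point, and its inverse maps `ε_a` to `(T_a, N_a)`. -/
theorem contMDiff_coordField (hFs : ContMDiff (𝓡 n) 𝓘(ℝ, Euc (n + 1)) ∞ F)
    (hF : ∀ p, Function.Injective (diff F p)) (hN : IsUnitNormal F N) (a : Fin (n + 1)) :
    ContMDiff (𝓡 n) (𝓡 n).tangent ∞ (fun q ↦ (coordField F a q : TangentBundle (𝓡 n) M)) := by
  intro p
  let X : Fin n → ∀ q : M, TangentSpace (𝓡 n) q := fun i ↦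
    extend (Euc n) (show TangentSpace (𝓡 n) p from (EuclideanSpace.single i (1 : ℝ) : Euc n))
  have hX : ∀ i, ContMDiffAt (𝓡 n) (𝓡 n).tangent ∞ (fun q ↦ (X i q : TangentBundle (𝓡 n) M)) p :=
    fun i ↦ contMDiffAt_extend (𝓡 n) (Euc n) _
  -- the isomorphisms `(c, t) ↦ dF (∑ i, c i • X i) + t • N`
  let L : M → (Euc n × ℝ →L[ℝ] Euc (n + 1)) := fun q ↦
    ∑ i, ((EuclideanSpace.proj i).comp (ContinuousLinearMap.fst ℝ (Euc n) ℝ)).smulRight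
      (diff F q (X i q)) + (ContinuousLinearMap.snd ℝ (Euc n) ℝ).smulRight (N q)
  have hLapp : ∀ q c, L q c = diff F q (∑ i, c.1 i • X i q) + c.2 • N q := by
    intro q c
    simp [L]
  have hL : ContMDiffAt (𝓡 n) 𝓘(ℝ, Euc n × ℝ →L[ℝ] Euc (n + 1)) ∞ L p := by
    refine ContMDiffAt.add (ContMDiffAt.sum fun i _ ↦ ?_) ?_
    · exact (ContinuousLinearMap.smulRightL ℝ (Euc n × ℝ) (Euc (n + 1)) _).contMDiff.contMDiffAt.comp
        p (contMDiffAt_diff_apply hFs (hX i))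
    · exact (ContinuousLinearMap.smulRightL ℝ (Euc n × ℝ) (Euc (n + 1)) _).contMDiff.contMDiffAt.comp
        p (hN.contMDiff p)
  have hLinj : Function.Injective (L p) := by
    refine (injective_iff_map_eq_zero _).2 fun c hc ↦ ?_
    rw [hLapp] at hc
    have h1 : c.2 = 0 := by
      have := congrArg (fun x ↦ inner ℝ x (N p)) hc
      rwa [inner_add_left, hN.inner_eq_zero, real_inner_smul_left, real_inner_self_eq_norm_sq,
        hN.norm_eq_one, inner_zero_left, zero_add, one_pow, mul_one] at this
    rw [h1, zero_smul, add_zero] at hc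
    have h2 : ∑ i, c.1 i • X i p = 0 := hF p (hc.trans (map_zero (diff F p)).symm)
    have h3 : c.1 = (∑ i, c.1 i • X i p : TangentSpace (𝓡 n) p) := by
      have h4 : ∀ i, X i p = (EuclideanSpace.single i (1 : ℝ) : Euc n) := fun i ↦
        extend_apply_self (F := Euc n) (E := fun q : M ↦ TangentSpace (𝓡 n) q) _
      have h5 : c.1 = ∑ i, c.1 i • EuclideanSpace.single i (1 : ℝ) := by
        simpa using ((EuclideanSpace.basisFun (Fin n) ℝ).sum_repr c.1).symm
      exact h5.trans (Finset.sum_congr rfl fun i _ ↦ congrArg (c.1 i • ·) (h4 i).symm)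
    exact Prod.ext (h3.trans h2) h1
  let e : (Euc n × ℝ) ≃L[ℝ] Euc (n + 1) :=
    ((L p).toLinearMap.linearEquivOfInjective hLinj (by simp)).toContinuousLinearEquiv
  have he : (e : Euc n × ℝ →L[ℝ] Euc (n + 1)) = L p := rfl
  let c : M → Euc n × ℝ := fun q ↦ (L q).inverse (EuclideanSpace.single a 1)
  have hc : ContMDiffAt (𝓡 n) 𝓘(ℝ, Euc n × ℝ) ∞ c p := by
    have h1 : ContDiffAt ℝ ∞ (ContinuousLinearMap.inverse :
        (Euc n × ℝ →L[ℝ] Euc (n + 1)) → (Euc (n + 1) →L[ℝ] Euc n × ℝ)) (L p) := by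
      rw [← he]; exact contDiffAt_map_inverse e
    have h2 := h1.contMDiffAt.comp p hL
    exact h2.clm_apply contMDiffAt_const
  have hLc : ∀ᶠ q in nhds p, L q (c q) = EuclideanSpace.single a 1 := by
    have h1 : ∀ᶠ A in nhds (L p), A ∈ Set.range
        ((↑) : ((Euc n × ℝ) ≃L[ℝ] Euc (n + 1)) → (Euc n × ℝ →L[ℝ] Euc (n + 1))) := by
      rw [← he]; exact ContinuousLinearEquiv.nhds e
    filter_upwards [hL.continuousAt.eventually h1] with q hq
    obtain ⟨e', he'⟩ := hq
    simp only [c, ← he', ContinuousLinearMap.inverse_equiv]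
    exact e'.apply_symm_apply _
  have hT : ∀ᶠ q in nhds p, coordField F a q = ∑ i, (c q).1 i • X i q := by
    filter_upwards [hLc] with q hq
    rw [coordField, ← hq, hLapp, map_add, map_smul, tangentPart_normal hF hN, smul_zero, add_zero,
      tangentPart_diff hF]
  have hsum : ContMDiffAt (𝓡 n) (𝓡 n).tangent ∞
      (fun q ↦ ((∑ i, (c q).1 i • X i q : TangentSpace (𝓡 n) q) : TangentBundle (𝓡 n) M)) p := by
    refine ContMDiffAt.sum_section fun i _ ↦ ContMDiffAt.smul_section ?_ (hX i)
    exact ((EuclideanSpace.proj (𝕜 := ℝ) i).comp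
      (ContinuousLinearMap.fst ℝ (Euc n) ℝ)).contMDiff.contMDiffAt.comp p hc
  refine hsum.congr_of_eventuallyEq ?_
  filter_upwards [hT] with q hq
  rw [hq]

end Fields

/-! ### Differentiation in components -/

section Tensors

open scoped RealInnerProductSpace
open FiberBundle VectorField

variable {n : ℕ} {Γ : Submodule ℤ (Euc (n + 1))} [DiscreteTopology Γ]
  {M : Type*} [TopologicalSpace M] [ChartedSpace (Euc n) M]
  {F : M → FlatTorus Γ} {N : M → Euc (n + 1)}

/-- The Leibniz rule for a finite sum of products, with the differentiability of the sum. -/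
theorem mvfderiv_sum_mul {ι : Type*} (s : Finset ι) {f g : ι → M → ℝ} {p : M}
    (hf : ∀ i, MDifferentiableAt (𝓡 n) 𝓘(ℝ, ℝ) (f i) p)
    (hg : ∀ i, MDifferentiableAt (𝓡 n) 𝓘(ℝ, ℝ) (g i) p) (v : TangentSpace (𝓡 n) p) :
    MDifferentiableAt (𝓡 n) 𝓘(ℝ, ℝ) (fun q ↦ ∑ i ∈ s, f i q * g i q) p ∧
    mvfderiv (𝓡 n) (fun q ↦ ∑ i ∈ s, f i q * g i q) p v =
      ∑ i ∈ s, (f i p * mvfderiv (𝓡 n) (g i) p v + g i p * mvfderiv (𝓡 n) (f i) p v) := by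
  classical
  induction s using Finset.induction_on with
  | empty =>
    simp only [Finset.sum_empty]
    exact ⟨mdifferentiableAt_const, by rw [mvfderiv_const]; rfl⟩
  | insert i s hi ih =>
    simp only [Finset.sum_insert hi]
    have h1 := (hf i).mul (hg i)
    refine ⟨h1.add ih.1, ?_⟩
    have h2 : mvfderiv (𝓡 n) (fun q ↦ f i q * g i q + ∑ i ∈ s, f i q * g i q) p =
        mvfderiv (𝓡 n) (fun q ↦ f i q * g i q) p +
          mvfderiv (𝓡 n) (fun q ↦ ∑ i ∈ s, f i q * g i q) p := mvfderiv_fun_add h1 ih.1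
    rw [h2, add_apply, ih.2, mvfderiv_fun_mul (hf i) (hg i)]
    rfl

theorem mvfderiv_coord {x : M → Euc (n + 1)} {p : M}
    (hx : MDifferentiableAt (𝓡 n) 𝓘(ℝ, Euc (n + 1)) x p) (a : Fin (n + 1))
    (v : TangentSpace (𝓡 n) p) :
    MDifferentiableAt (𝓡 n) 𝓘(ℝ, ℝ) (fun q ↦ x q a) p ∧
    mvfderiv (𝓡 n) (fun q ↦ x q a) p v = mvfderiv (𝓡 n) x p v a := by
  have h := (EuclideanSpace.proj (𝕜 := ℝ) (ι := Fin (n + 1)) a).hasMFDerivAt.comp p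
    hx.hasMFDerivAt
  exact ⟨h.mdifferentiableAt, DFunLike.congr_fun h.mfderiv v⟩

/-! ### Orthonormal frames and traces -/

theorem sum_inner_smul_frame (hF : ∀ p, Function.Injective (diff F p)) {p : M} {ι : Type*}
    [Fintype ι] (b : OrthonormalBasis ι ℝ (LinearMap.range (diff F p).toLinearMap))
    {e : ι → TangentSpace (𝓡 n) p} (he : ∀ i, diff F p (e i) = b i) (x : Euc (n + 1)) :
    ∑ i, ⟪diff F p (e i), x⟫ • e i = tangentPart F p x := by
  have h1 : ∑ i, ⟪(b i : Euc (n + 1)), x⟫ • (b i : Euc (n + 1)) =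
      (LinearMap.range (diff F p).toLinearMap).starProjection x := by
    have := b.starProjection_eq_sum_rankOne
    rw [this]
    simp [InnerProductSpace.rankOne_apply]
  have h2 : tangentPart F p ((LinearMap.range (diff F p).toLinearMap).starProjection x) =
      tangentPart F p x := by
    simp only [tangentPart, LinearMap.comp_apply]
    refine congrArg _ ?_
    exact Submodule.starProjection_eq_self_iff.2 (Submodule.starProjection_apply_mem _ _)
  rw [← h2, ← h1, map_sum]
  refine Finset.sum_congr rfl fun i _ ↦ ?_
  rw [map_smul, ← he, tangentPart_diff hF]

/-- The vectors `e_i` form a Parseval frame of `T_pM`: they satisfy `∑ i, ⟨dF e_i, x⟩ e_i = x^⊤` for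
every ambient vector `x`. It is enough to require this for the standard basis, where it reads
`∑ i, (dF e_i)_a e_i = T_a`. The index type is arbitrary so that the notion covers both the
frames `Fin n → T_pM` and `stdFrame`. -/
def IsParsevalFrame (F : M → FlatTorus Γ) (p : M) {ι : Type*} [Fintype ι]
    (e : ι → TangentSpace (𝓡 n) p) : Prop :=
  ∀ a, ∑ i, diff F p (e i) a • e i = coordField F a p

theorem isParsevalFrame_of_basis (hF : ∀ p, Function.Injective (diff F p)) {p : M} {ι : Type*}
    [Fintype ι] (b : OrthonormalBasis ι ℝ (LinearMap.range (diff F p).toLinearMap))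
    {e : ι → TangentSpace (𝓡 n) p} (he : ∀ i, diff F p (e i) = b i) : IsParsevalFrame F p e := by
  intro a
  rw [coordField, ← sum_inner_smul_frame hF b he]
  simp [EuclideanSpace.inner_single_right]

theorem isParsevalFrame_stdFrame (hF : ∀ p, Function.Injective (diff F p)) (p : M) :
    IsParsevalFrame F p (stdFrame F p) := by
  refine isParsevalFrame_of_basis hF (stdOrthonormalBasis ℝ _) fun i ↦ ?_
  obtain ⟨v, hv⟩ := (stdOrthonormalBasis ℝ (LinearMap.range (diff F p).toLinearMap) i).2
  have hv' : diff F p v = _ := hv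
  rw [stdFrame, ← hv', tangentPart_diff hF]

theorem IsOrthonormalFrameAt.isParsevalFrame (hF : ∀ p, Function.Injective (diff F p)) {p : M}
    {e : Fin n → TangentSpace (𝓡 n) p} (he : IsOrthonormalFrameAt F p e) :
    IsParsevalFrame F p e := by
  let w : Fin n → LinearMap.range (diff F p).toLinearMap := fun i ↦ ⟨diff F p (e i), e i, rfl⟩
  have hw : Orthonormal ℝ w := by
    rw [orthonormal_iff_ite]
    exact he
  have hcard : Module.finrank ℝ (LinearMap.range (diff F p).toLinearMap) =
      Fintype.card (Fin n) := by
    rw [LinearMap.finrank_range_of_inj (hF p), Fintype.card_fin]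
    exact finrank_euclideanSpace_fin
  obtain ⟨b, hb⟩ := Orthonormal.exists_orthonormalBasis_extension_of_card_eq hcard
    (s := Set.univ) (v := w) (hw.comp _ Subtype.val_injective)
  exact isParsevalFrame_of_basis hF b fun i ↦ by rw [hb i (Set.mem_univ i)]

/-- A Parseval frame and the fields `T_a` compute the same trace of a bilinear form. -/
theorem IsParsevalFrame.sum_apply (hF : ∀ p, Function.Injective (diff F p)) {p : M} {ι : Type*}
    [Fintype ι] {e : ι → TangentSpace (𝓡 n) p} (he : IsParsevalFrame F p e)
    (B : TangentSpace (𝓡 n) p →ₗ[ℝ] TangentSpace (𝓡 n) p →ₗ[ℝ] ℝ) :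
    ∑ i, B (e i) (e i) = ∑ a, B (coordField F a p) (coordField F a p) := by
  have h1 : ∀ i, B (e i) (e i) = ∑ a, diff F p (e i) a • B (coordField F a p) (e i) := fun i ↦ by
    have := congrArg (fun v ↦ B v (e i)) (eq_sum_coordField hF p (e i))
    simpa only [map_sum, map_smul, LinearMap.sum_apply, LinearMap.smul_apply] using this
  simp only [h1]
  rw [Finset.sum_comm]
  refine Finset.sum_congr rfl fun a _ ↦ ?_
  have := congrArg (B (coordField F a p)) (he a)
  simpa only [map_sum, map_smul] using this

end Tensors

/-! ### Tensors in components -/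

section Tensors

open scoped RealInnerProductSpace
open FiberBundle VectorField

variable {n : ℕ} {Γ : Submodule ℤ (Euc (n + 1))} [DiscreteTopology Γ]
  {M : Type*} [TopologicalSpace M] [ChartedSpace (Euc n) M] [IsManifold (𝓡 n) ∞ M]
  {F : M → FlatTorus Γ} {N : M → Euc (n + 1)}

theorem mdifferentiableAt_diff_extend (hFs : ContMDiff (𝓡 n) 𝓘(ℝ, Euc (n + 1)) ∞ F) {p : M}
    (w : TangentSpace (𝓡 n) p) :
    MDifferentiableAt (𝓡 n) 𝓘(ℝ, Euc (n + 1)) (fun q ↦ diff F q (extend (Euc n) w q)) p :=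
  (contMDiffAt_diff_apply hFs (contMDiffAt_extend (𝓡 n) (Euc n) w)).mdifferentiableAt (by simp)

/-- The derivative of `α(W)` for the extension `W` of `w` splits into a part that depends on `w` only
and the part `α(∇_v W)` that the covariant derivative removes. -/
theorem mvfderiv_oneForm_extend (hFs : ContMDiff (𝓡 n) 𝓘(ℝ, Euc (n + 1)) ∞ F)
    (hF : ∀ p, Function.Injective (diff F p)) {α : ∀ q : M, TangentSpace (𝓡 n) q →L[ℝ] ℝ} {p : M}
    (hα : ∀ a, MDifferentiableAt (𝓡 n) 𝓘(ℝ, ℝ) (fun q ↦ α q (coordField F a q)) p)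
    (v w : TangentSpace (𝓡 n) p) :
    mvfderiv (𝓡 n) (fun q ↦ α q (extend (Euc n) w q)) p v =
      ∑ a, mvfderiv (𝓡 n) (fun q ↦ α q (coordField F a q)) p v * diff F p w a +
        α p (tangentPart F p (ambientDeriv F (extend (Euc n) w) p v)) := by
  set x : M → Euc (n + 1) := fun q ↦ diff F q (extend (Euc n) w q) with hx
  have hxd : MDifferentiableAt (𝓡 n) 𝓘(ℝ, Euc (n + 1)) x p := mdifferentiableAt_diff_extend hFs w
  have h1 : (fun q ↦ α q (extend (Euc n) w q)) = fun q ↦ ∑ a, x q a * α q (coordField F a q) := by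
    funext q
    have := congrArg (α q) (eq_sum_coordField hF q (extend (Euc n) w q))
    simpa only [map_sum, map_smul, smul_eq_mul] using this
  have hxp : x p = diff F p w := by simp [hx]
  rw [h1, (mvfderiv_sum_mul _ (fun a ↦ (mvfderiv_coord hxd a v).1) hα v).2, tangentPart_eq_sum,
    map_sum, ← Finset.sum_add_distrib]
  refine Finset.sum_congr rfl fun a _ ↦ ?_
  rw [(mvfderiv_coord hxd a v).2, map_smul, hxp, smul_eq_mul]
  simp only [ambientDeriv]
  rw [mul_comm (diff F p w a), mul_comm (α p _)]

/-- `∇α` in terms of the functions `α(T_a)`: `(∇_v α)(w) = ∑ a, v(α(T_a)) (dF w)_a`. The extension of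
`w` chosen in the definition has disappeared. -/
theorem nablaOneForm_eq_sum (hFs : ContMDiff (𝓡 n) 𝓘(ℝ, Euc (n + 1)) ∞ F)
    (hF : ∀ p, Function.Injective (diff F p)) {α : ∀ q : M, TangentSpace (𝓡 n) q →L[ℝ] ℝ} {p : M}
    (hα : ∀ a, MDifferentiableAt (𝓡 n) 𝓘(ℝ, ℝ) (fun q ↦ α q (coordField F a q)) p)
    (v w : TangentSpace (𝓡 n) p) :
    nablaOneForm F α p v w =
      ∑ a, mvfderiv (𝓡 n) (fun q ↦ α q (coordField F a q)) p v * diff F p w a := by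
  rw [nablaOneForm, mvfderiv_oneForm_extend hFs hF hα]
  simp only [nabla, add_sub_cancel_right]

theorem extDerivOneForm_eq_sum (hFs : ContMDiff (𝓡 n) 𝓘(ℝ, Euc (n + 1)) ∞ F)
    (hF : ∀ p, Function.Injective (diff F p)) {α : ∀ q : M, TangentSpace (𝓡 n) q →L[ℝ] ℝ} {p : M}
    (hα : ∀ a, MDifferentiableAt (𝓡 n) 𝓘(ℝ, ℝ) (fun q ↦ α q (coordField F a q)) p)
    (v w : TangentSpace (𝓡 n) p) :
    extDerivOneForm α p v w =
      ∑ a, (mvfderiv (𝓡 n) (fun q ↦ α q (coordField F a q)) p v * diff F p w a -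
        mvfderiv (𝓡 n) (fun q ↦ α q (coordField F a q)) p w * diff F p v a) := by
  have h1 : mlieBracket (𝓡 n) (extend (Euc n) v) (extend (Euc n) w) p =
      tangentPart F p (ambientDeriv F (extend (Euc n) w) p v) -
        tangentPart F p (ambientDeriv F (extend (Euc n) v) p w) := by
    rw [← map_sub, ← tangentPart_diff hF p (mlieBracket _ _ _ _),
      diff_mlieBracket hFs (contMDiffAt_extend (𝓡 n) (Euc n) v)
        (contMDiffAt_extend (𝓡 n) (Euc n) w), extend_apply_self, extend_apply_self]
  rw [extDerivOneForm, mvfderiv_oneForm_extend hFs hF hα, mvfderiv_oneForm_extend hFs hF hα, h1,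
    map_sub, Finset.sum_sub_distrib]
  ring

theorem nablaTwoTensor_eq_sum (hFs : ContMDiff (𝓡 n) 𝓘(ℝ, Euc (n + 1)) ∞ F)
    (hF : ∀ p, Function.Injective (diff F p))
    (B : ∀ q : M, TangentSpace (𝓡 n) q →ₗ[ℝ] TangentSpace (𝓡 n) q →ₗ[ℝ] ℝ) {p : M}
    (hB : ∀ a b, MDifferentiableAt (𝓡 n) 𝓘(ℝ, ℝ)
      (fun q ↦ B q (coordField F a q) (coordField F b q)) p)
    (v w z : TangentSpace (𝓡 n) p) :
    nablaTwoTensor F (fun q v w ↦ B q v w) p v w z =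
      ∑ a, ∑ b, mvfderiv (𝓡 n) (fun q ↦ B q (coordField F a q) (coordField F b q)) p v *
        diff F p w a * diff F p z b := by
  set x : M → Euc (n + 1) := fun q ↦ diff F q (extend (Euc n) w q) with hx
  set y : M → Euc (n + 1) := fun q ↦ diff F q (extend (Euc n) z q) with hy
  have hxd : MDifferentiableAt (𝓡 n) 𝓘(ℝ, Euc (n + 1)) x p := mdifferentiableAt_diff_extend hFs w
  have hyd : MDifferentiableAt (𝓡 n) 𝓘(ℝ, Euc (n + 1)) y p := mdifferentiableAt_diff_extend hFs z
  have hxp : x p = diff F p w := by simp [hx]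
  have hyp : y p = diff F p z := by simp [hy]
  have hlin : ∀ q (r s : Euc (n + 1)), B q (tangentPart F q r) (tangentPart F q s) =
      ∑ a, r a * ∑ b, s b * B q (coordField F a q) (coordField F b q) := fun q r s ↦ by
    rw [tangentPart_eq_sum F q r, tangentPart_eq_sum F q s]
    simp only [map_sum, map_smul, LinearMap.sum_apply, LinearMap.smul_apply, smul_eq_mul,
      Finset.mul_sum]
    rw [Finset.sum_comm]
    exact Finset.sum_congr rfl fun a _ ↦ Finset.sum_congr rfl fun b _ ↦ by ring
  have h1 : (fun q ↦ B q (extend (Euc n) w q) (extend (Euc n) z q)) =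
      fun q ↦ ∑ a, x q a * ∑ b, y q b * B q (coordField F a q) (coordField F b q) := by
    funext q
    rw [← hlin q (x q) (y q), tangentPart_diff hF, tangentPart_diff hF]
  have h2 := fun a ↦ mvfderiv_sum_mul Finset.univ (fun b ↦ (mvfderiv_coord hyd b v).1) (hB a) v
  have hw : w = tangentPart F p (x p) := by rw [hxp, tangentPart_diff hF]
  have hz : z = tangentPart F p (y p) := by rw [hyp, tangentPart_diff hF]
  have h3 : B p (nabla F (extend (Euc n) w) p v) z = ∑ a, mvfderiv (𝓡 n) x p v a *
      ∑ b, y p b * B p (coordField F a p) (coordField F b p) := by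
    conv_lhs => rw [hz]
    exact hlin p _ _
  have h4 : B p w (nabla F (extend (Euc n) z) p v) = ∑ a, x p a *
      ∑ b, mvfderiv (𝓡 n) y p v b * B p (coordField F a p) (coordField F b p) := by
    conv_lhs => rw [hw]
    exact hlin p _ _
  rw [nablaTwoTensor, h1, h3, h4,
    (mvfderiv_sum_mul _ (fun a ↦ (mvfderiv_coord hxd a v).1) (fun a ↦ (h2 a).1) v).2,
    ← Finset.sum_sub_distrib, ← Finset.sum_sub_distrib]
  refine Finset.sum_congr rfl fun a _ ↦ ?_
  rw [(h2 a).2, (mvfderiv_coord hxd a v).2, ← hxp, ← hyp]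
  rw [Finset.mul_sum, Finset.mul_sum, Finset.mul_sum, Finset.sum_mul, ← Finset.sum_add_distrib,
    ← Finset.sum_sub_distrib, ← Finset.sum_sub_distrib]
  refine Finset.sum_congr rfl fun b _ ↦ ?_
  rw [(mvfderiv_coord hyd b v).2]
  ring

/-- The Weingarten equation `A(v, w) = -⟨D_v N, dF w⟩`. -/
theorem secondFF_eq_sum (hFs : ContMDiff (𝓡 n) 𝓘(ℝ, Euc (n + 1)) ∞ F) (hN : IsUnitNormal F N)
    (p : M) (v w : TangentSpace (𝓡 n) p) :
    secondFF F N p v w = -∑ a, mvfderiv (𝓡 n) (fun q ↦ N q a) p v * diff F p w a := by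
  set x : M → Euc (n + 1) := fun q ↦ diff F q (extend (Euc n) w q) with hx
  have hxd : MDifferentiableAt (𝓡 n) 𝓘(ℝ, Euc (n + 1)) x p := mdifferentiableAt_diff_extend hFs w
  have hNd : MDifferentiableAt (𝓡 n) 𝓘(ℝ, Euc (n + 1)) N p :=
    (hN.contMDiff p).mdifferentiableAt (by simp)
  have hxp : x p = diff F p w := by simp [hx]
  have h1 : (fun q ↦ ∑ a, x q a * N q a) = fun _ ↦ (0 : ℝ) := by
    funext q
    rw [← hN.inner_eq_zero q (extend (Euc n) w q)]
    simp [PiLp.inner_apply, hx, mul_comm]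
  have h2 := (mvfderiv_sum_mul Finset.univ (fun a ↦ (mvfderiv_coord hxd a v).1)
    (fun a ↦ (mvfderiv_coord hNd a v).1) v).2
  rw [h1, mvfderiv_const, Finset.sum_add_distrib, hxp] at h2
  have h3 : secondFF F N p v w = ∑ a, N p a * mvfderiv (𝓡 n) (fun q ↦ x q a) p v := by
    simp only [(mvfderiv_coord hxd _ v).2]
    simp [secondFF, ambientDeriv, PiLp.inner_apply, hx]
  have h4 : (0 : TangentSpace (𝓡 n) p →L[ℝ] ℝ) v = 0 := rfl
  have h5 : ∑ a, mvfderiv (𝓡 n) (fun q ↦ N q a) p v * diff F p w a =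
      ∑ a, diff F p w a * mvfderiv (𝓡 n) (fun q ↦ N q a) p v :=
    Finset.sum_congr rfl fun a _ ↦ mul_comm _ _
  rw [h3, h5]
  linarith

end Tensors

/-! ### Two-forms of the torus -/

section Ring

open scoped RealInnerProductSpace
open FiberBundle VectorField

variable {n : ℕ} {Γ : Submodule ℤ (Euc (n + 1))} [DiscreteTopology Γ]
  {M : Type*} [TopologicalSpace M] [ChartedSpace (Euc n) M]
  {F : M → FlatTorus Γ} {N : M → Euc (n + 1)}

theorem twoForm_swap (θ : Euc (n + 1) [⋀^Fin 2]→L[ℝ] ℝ) (x y : Euc (n + 1)) :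
    θ ![x, y] = -θ ![y, x] := by
  have := θ.map_swap ![y, x] (i := 0) (j := 1) (by simp)
  refine Eq.trans ?_ this
  refine congrArg θ ?_
  funext i
  fin_cases i <;> simp

/-- `⟨α ∧ β, θ⟩ = ∑ a, ∑ b, θ_ab α_a β_b`, the sum over all pairs of indices. -/
theorem innerTwoForm_wedge (α β : Euc (n + 1) → ℝ) (θ : Euc (n + 1) [⋀^Fin 2]→L[ℝ] ℝ) :
    innerTwoForm (wedge α β) θ = ∑ a, ∑ b,
      θ ![EuclideanSpace.single a 1, EuclideanSpace.single b 1] *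
        (α (EuclideanSpace.single a 1) * β (EuclideanSpace.single b 1)) := by
  set t : Fin (n + 1) → Fin (n + 1) → ℝ := fun a b ↦
    θ ![EuclideanSpace.single a 1, EuclideanSpace.single b 1] with ht
  set α' : Fin (n + 1) → ℝ := fun a ↦ α (EuclideanSpace.single a 1)
  set β' : Fin (n + 1) → ℝ := fun a ↦ β (EuclideanSpace.single a 1)
  have hswap : ∀ a b, t a b = -t b a := fun a b ↦ twoForm_swap θ _ _
  have h1 : innerTwoForm (wedge α β) θ =
      ∑ a, ∑ b, if a < b then (α' a * β' b - α' b * β' a) * t a b else 0 := by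
    simp only [innerTwoForm, wedge, ← Finset.sum_filter]
    refine Finset.sum_congr rfl fun a _ ↦ Finset.sum_congr ?_ fun _ _ ↦ rfl
    ext b; simp
  have h2 : ∑ a, ∑ b, (if a < b then α' b * β' a * t a b else 0) =
      -∑ a, ∑ b, if b < a then α' a * β' b * t a b else 0 := by
    rw [Finset.sum_comm, ← Finset.sum_neg_distrib]
    refine Finset.sum_congr rfl fun a _ ↦ ?_
    rw [← Finset.sum_neg_distrib]
    refine Finset.sum_congr rfl fun b _ ↦ ?_
    rw [hswap a b]
    split_ifs <;> ring
  have h3 : ∀ a b, (if a < b then (α' a * β' b - α' b * β' a) * t a b else 0) =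
      (if a < b then α' a * β' b * t a b else 0) - if a < b then α' b * β' a * t a b else 0 :=
    fun a b ↦ by split_ifs <;> ring
  rw [h1]
  simp only [h3, Finset.sum_sub_distrib]
  rw [h2, sub_neg_eq_add, ← Finset.sum_add_distrib]
  refine Finset.sum_congr rfl fun a _ ↦ ?_
  rw [← Finset.sum_add_distrib]
  refine Finset.sum_congr rfl fun b _ ↦ ?_
  rcases lt_trichotomy a b with h | rfl | h
  · simp [h, h.not_gt]; ring
  · have : t a a = 0 := by linarith [hswap a a]
    simpa using Or.inl this
  · simp [h, h.not_gt]; ring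

/-- The components of a parallel two-form are smooth and constant along `M`, in the sense that their
differential vanishes. -/
theorem mvfderiv_twoForm_comp {θ : FlatTorus Γ → Euc (n + 1) [⋀^Fin 2]→L[ℝ] ℝ}
    (hθ : IsParallelTwoForm θ) (hFs : ContMDiff (𝓡 n) 𝓘(ℝ, Euc (n + 1)) ∞ F)
    (x : Fin 2 → Euc (n + 1)) :
    ContMDiff (𝓡 n) 𝓘(ℝ, ℝ) ∞ (fun q ↦ θ (F q) x) ∧
      ∀ q, mvfderiv (𝓡 n) (fun q ↦ θ (F q) x) q = 0 := by
  have h2 : ContMDiff (𝓡 n) 𝓘(ℝ, Euc (n + 1) [⋀^Fin 2]→L[ℝ] ℝ) ∞ (fun q ↦ θ (F q)) :=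
    hθ.contMDiff.comp hFs
  refine ⟨(ContinuousAlternatingMap.apply ℝ (Euc (n + 1)) ℝ x).contMDiff.comp h2, fun q ↦ ?_⟩
  have h3 : HasMFDerivAt (𝓡 n) 𝓘(ℝ, Euc (n + 1) [⋀^Fin 2]→L[ℝ] ℝ) (fun q ↦ θ (F q)) q _ :=
    ((hθ.contMDiff (F q)).mdifferentiableAt (by simp)).hasMFDerivAt.comp q
      ((hFs q).mdifferentiableAt (by simp)).hasMFDerivAt
  have h4 := (ContinuousAlternatingMap.apply ℝ (Euc (n + 1)) ℝ x).hasMFDerivAt.comp q h3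
  ext v
  refine (DFunLike.congr_fun h4.mfderiv v).trans ?_
  have h5 : mfderiv 𝓘(ℝ, Euc (n + 1)) 𝓘(ℝ, Euc (n + 1) [⋀^Fin 2]→L[ℝ] ℝ) θ (F q)
      (diff F q v) = (0 : Euc (n + 1) [⋀^Fin 2]→L[ℝ] ℝ) :=
    DFunLike.congr_fun (hθ.deriv_eq_zero (F q)) (diff F q v)
  exact (congrArg (ContinuousAlternatingMap.apply ℝ (Euc (n + 1)) ℝ x) h5).trans (map_zero _)

/-! ### Derivations of the ring of smooth functions -/

variable [IsManifold (𝓡 n) ∞ M]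

/-- The derivation `f ↦ df(X)` of the ring of smooth functions given by a smooth vector field. -/
def fieldDerivation (X : ∀ q : M, TangentSpace (𝓡 n) q)
    (hX : ContMDiff (𝓡 n) (𝓡 n).tangent ∞ (fun q ↦ (X q : TangentBundle (𝓡 n) M))) :
    Derivation ℝ C^∞⟮𝓡 n, M; 𝓘(ℝ, ℝ), ℝ⟯ C^∞⟮𝓡 n, M; 𝓘(ℝ, ℝ), ℝ⟯ :=
  Derivation.mk'
    { toFun := fun f ↦ ⟨fun q ↦ mvfderiv (𝓡 n) f q (X q), fun q ↦
        contMDiffAt_mvfderiv_apply (f.contMDiff q) (hX q)⟩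
      map_add' := fun f g ↦ by
        ext q
        have := mvfderiv_add (I := 𝓡 n) (f.mdifferentiableAt (x := q)) (g.mdifferentiableAt (x := q))
        exact DFunLike.congr_fun this (X q)
      map_smul' := fun c f ↦ by
        ext q
        have := mvfderiv_smul (I := 𝓡 n) (a := fun _ : M ↦ c) mdifferentiableAt_const
          (f.mdifferentiableAt (x := q))
        rw [mvfderiv_const] at this
        have h0 : (0 : TangentSpace (𝓡 n) q →L[ℝ] ℝ).smulRight (f q) (X q) = 0 :=
          zero_smul ℝ (f q)
        exact (DFunLike.congr_fun this (X q)).trans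
          ((congrArg (c • mvfderiv (𝓡 n) f q (X q) + ·) h0).trans (add_zero _)) }
    fun f g ↦ by
      ext q
      have := mvfderiv_mul (I := 𝓡 n) (f.mdifferentiableAt (x := q)) (g.mdifferentiableAt (x := q))
      exact DFunLike.congr_fun this (X q)

theorem contMDiff_oneForm_apply {α : ∀ q : M, TangentSpace (𝓡 n) q →L[ℝ] ℝ} (hα : IsSmoothOneForm α)
    {X : ∀ q : M, TangentSpace (𝓡 n) q}
    (hX : ContMDiff (𝓡 n) (𝓡 n).tangent ∞ (fun q ↦ (X q : TangentBundle (𝓡 n) M))) :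
    ContMDiff (𝓡 n) 𝓘(ℝ, ℝ) ∞ (fun q ↦ α q (X q)) := by
  intro q
  have := ContMDiffAt.clm_bundle_apply (hα q) (hX q)
  exact (Bundle.contMDiffAt_totalSpace.1 this).2

end Ring

/-! ### Identities for tangential derivations of a ring -/

/-- The equation `ΔN_b = -|A|² N_b` of a minimal hypersurface. By symmetry `δ_a δ_a N_b = δ_a δ_b N_a`;
after commuting the derivations, `∑ a, δ_b δ_a N_a` vanishes by minimality and the commutators
sum up to `-|A|² N_b`. -/
theorem sum_deriv_deriv_normal {R ι : Type*} [CommRing R] [Algebra ℝ R] [Fintype ι]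
    (δ : ι → Derivation ℝ R R) (N : ι → R)
    (hNδ : ∀ f, ∑ a, N a * δ a f = 0) (hsym : ∀ a b, δ a (N b) = δ b (N a))
    (hcomm : ∀ a b f, δ a (δ b f) - δ b (δ a f) =
      ∑ c, (N a * δ b (N c) - N b * δ a (N c)) * δ c f)
    (hmin : ∑ a, δ a (N a) = 0) (b : ι) :
    ∑ a, δ a (δ a (N b)) = -(∑ a, ∑ c, δ a (N c) ^ 2) * N b := by
  have h1 : ∀ a, δ a (δ a (N b)) = δ b (δ a (N a)) +
      ∑ c, (N a * δ b (N c) - N b * δ a (N c)) * δ c (N a) := fun a ↦ by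
    rw [← hcomm a b (N a), hsym a b]; ring
  have h2 : ∑ a, δ b (δ a (N a)) = 0 := by rw [← map_sum, hmin, map_zero]
  have h3 : ∑ a, ∑ c, N a * δ b (N c) * δ c (N a) = 0 := by
    rw [Finset.sum_comm]
    refine Finset.sum_eq_zero fun c _ ↦ ?_
    calc ∑ a, N a * δ b (N c) * δ c (N a) = δ b (N c) * ∑ a, N a * δ a (N c) := by
          rw [Finset.mul_sum]
          exact Finset.sum_congr rfl fun a _ ↦ by rw [hsym c a]; ring
      _ = 0 := by rw [hNδ, mul_zero]
  simp only [h1, Finset.sum_add_distrib, h2, sub_mul, Finset.sum_sub_distrib, h3, zero_add, zero_sub,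
    neg_mul, Finset.sum_mul]
  congr 1
  exact Finset.sum_congr rfl fun a _ ↦ Finset.sum_congr rfl fun c _ ↦ by rw [hsym c a]; ring

/-- The Bochner formula for a harmonic one-form `α` on a minimal hypersurface. Here `Z_b = α(T_b)`
and `η_ab = dα(T_a, T_b)`, and `harm` states that the form `-dd^*α - d^*dα` vanishes on tangent
vectors, so that only a multiple `K` of the normal remains. By the Gauss equation the Ricci
curvature of a minimal hypersurface is `-A²`. It contributes one half of the factor `-2`; the other
half comes from differentiating the normal part of `D_a Z` once more. The normal component `L` is
left unspecified: contracted with `N_a` and an antisymmetric form it vanishes. -/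
theorem sum_deriv_deriv_harmonic {R ι : Type*} [CommRing R] [Algebra ℝ R] [Fintype ι]
    [DecidableEq ι] (δ : ι → Derivation ℝ R R) (N Z : ι → R) (η : ι → ι → R) (K : R)
    (hNδ : ∀ f, ∑ a, N a * δ a f = 0) (hsym : ∀ a b, δ a (N b) = δ b (N a))
    (hcomm : ∀ a b f, δ a (δ b f) - δ b (δ a f) =
      ∑ c, (N a * δ b (N c) - N b * δ a (N c)) * δ c f)
    (hmin : ∑ a, δ a (N a) = 0) (hNZ : ∑ a, N a * Z a = 0)
    (hη : ∀ a b, η a b = ∑ c, (δ a (Z c) * ((if b = c then 1 else 0) - N b * N c)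
      - δ b (Z c) * ((if a = c then 1 else 0) - N a * N c)))
    (harm : ∀ b, δ b (∑ a, δ a (Z a)) + ∑ a, δ a (η a b) = N b * K) :
    ∃ L : R, ∀ b, ∑ a, δ a (δ a (Z b)) = -2 * ∑ c, δ b (N c) * (∑ d, Z d * δ c (N d)) + N b * L := by
  set s : ι → R := fun a ↦ ∑ d, Z d * δ a (N d) with hs
  have hs' : ∀ a, ∑ c, N c * δ a (Z c) = -s a := fun a ↦ by
    have := congrArg (δ a) hNZ
    simp only [map_sum, map_zero, Derivation.leibniz, smul_eq_mul, Finset.sum_add_distrib] at this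
    linear_combination this
  have hη' : ∀ a b, η a b = δ a (Z b) - δ b (Z a) + N b * s a - N a * s b := fun a b ↦ by
    have h1 : ∀ a b, ∑ c, δ a (Z c) * ((if b = c then 1 else 0) - N b * N c)
        = δ a (Z b) + N b * s a := fun a b ↦ by
      have : ∑ c, δ a (Z c) * (N b * N c) = N b * ∑ c, N c * δ a (Z c) := by
        rw [Finset.mul_sum]; exact Finset.sum_congr rfl fun c _ ↦ by ring
      simp only [mul_sub, Finset.sum_sub_distrib, this, hs' a]
      simp
    rw [hη, Finset.sum_sub_distrib, h1, h1]; ring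
  have hd : ∀ b, ∑ a, δ a (η a b) = ∑ a, δ a (δ a (Z b)) - ∑ a, δ a (δ b (Z a))
      + ∑ a, δ a (N b) * s a + N b * ∑ a, δ a (s a) := fun b ↦ by
    have h1 : ∑ a, δ a (N a) * s b = 0 := by rw [← Finset.sum_mul, hmin, zero_mul]
    have h2 := hNδ (s b)
    have h3 : ∀ a, δ a (η a b) = δ a (δ a (Z b)) - δ a (δ b (Z a)) + δ a (N b) * s a
        + N b * δ a (s a) - δ a (N a) * s b - N a * δ a (s b) := fun a ↦ by
      rw [hη']
      simp only [map_sub, map_add, Derivation.leibniz, smul_eq_mul]; ring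
    simp only [h3, Finset.sum_sub_distrib, Finset.sum_add_distrib, h1, h2, ← Finset.mul_sum]
    ring
  have hc : ∀ b, ∑ a, δ a (δ b (Z a)) = δ b (∑ a, δ a (Z a)) - ∑ c, δ b (N c) * s c
      - N b * ∑ a, ∑ c, δ a (N c) * δ c (Z a) := fun b ↦ by
    have h1 : ∀ a, δ a (δ b (Z a)) = δ b (δ a (Z a)) +
      ∑ c, (N a * δ b (N c) - N b * δ a (N c)) * δ c (Z a) := fun a ↦ by
        rw [← hcomm a b (Z a)]; ring
    have h2 : ∑ a, ∑ c, N a * δ b (N c) * δ c (Z a) = - ∑ c, δ b (N c) * s c := by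
      rw [Finset.sum_comm, ← Finset.sum_neg_distrib]
      refine Finset.sum_congr rfl fun c _ ↦ ?_
      rw [← mul_neg, ← hs' c, Finset.mul_sum]
      exact Finset.sum_congr rfl fun a _ ↦ by ring
    have h3 : ∑ a, ∑ c, N b * δ a (N c) * δ c (Z a) = N b * ∑ a, ∑ c, δ a (N c) * δ c (Z a) := by
      simp only [Finset.mul_sum, mul_assoc]
    simp only [h1, Finset.sum_add_distrib, ← map_sum, sub_mul, Finset.sum_sub_distrib, h2, h3]
    ring
  refine ⟨K - ∑ a, δ a (s a) - ∑ a, ∑ c, δ a (N c) * δ c (Z a), fun b ↦ ?_⟩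
  have h1 := harm b
  rw [hd b, hc b] at h1
  have h2 : ∑ a, δ a (N b) * s a = ∑ a, δ b (N a) * s a :=
    Finset.sum_congr rfl fun a _ ↦ by rw [hsym a b]
  rw [h2] at h1
  linear_combination h1

theorem eq_zero_of_two_mul_eq_zero {R : Type*} [CommRing R] [Algebra ℝ R] {x : R}
    (hx : 2 * x = 0) : x = 0 := by
  have : Invertible (2 : R) := (Invertible.map (algebraMap ℝ R) (2 : ℝ)).copy _ (map_ofNat _ 2).symm
  simpa using congrArg (⅟(2 : R) * ·) hx

theorem sum_mul_eq_zero_of_antisymm {R ι : Type*} [CommRing R] [Algebra ℝ R] [Fintype ι]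
    {t f : ι → ι → R} (ht : ∀ a b, t a b = -t b a) (hf : ∀ a b, f a b = f b a) :
    ∑ a, ∑ b, t a b * f a b = 0 := by
  have h : ∑ a, ∑ b, t a b * f a b = -∑ a, ∑ b, t a b * f a b := by
    conv_lhs => rw [Finset.sum_comm]
    simp only [← Finset.sum_neg_distrib]
    exact Finset.sum_congr rfl fun a _ ↦ Finset.sum_congr rfl fun b _ ↦ by
      rw [ht b a, hf b a, neg_mul]
  exact eq_zero_of_two_mul_eq_zero (by linear_combination h)

/-- The identity `Δu + |A|² u = 2 ∑ ⟨D_k N ∧ ∇_k α, θ⟩` for `u = ∑ a, ∑ b, t_ab N_a Z_b`, from the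
equations for `ΔN` and `ΔZ`. The right-hand side contains the tangential part of `δ_k Z`; the
difference to `δ_k Z` itself and the zeroth order term of `ΔZ` combine to an expression that is
symmetric in `a` and `b`, and therefore vanishes when contracted with the antisymmetric `t`. -/
theorem sum_deriv_deriv_test {R ι : Type*} [CommRing R] [Algebra ℝ R] [Fintype ι]
    [DecidableEq ι] (δ : ι → Derivation ℝ R R) (N Z : ι → R) (t : ι → ι → R) (L S : R)
    (hNδ : ∀ f, ∑ a, N a * δ a f = 0) (hsym : ∀ a b, δ a (N b) = δ b (N a))
    (hNZ : ∑ a, N a * Z a = 0)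
    (ht : ∀ a b, t a b = -t b a) (htδ : ∀ c a b, δ c (t a b) = 0)
    (hN : ∀ b, ∑ a, δ a (δ a (N b)) = - S * N b)
    (hZ : ∀ b, ∑ a, δ a (δ a (Z b)) = -2 * ∑ c, δ b (N c) * (∑ d, Z d * δ c (N d)) + N b * L) :
    ∑ k, δ k (δ k (∑ a, ∑ b, t a b * (N a * Z b))) + S * ∑ a, ∑ b, t a b * (N a * Z b) =
      2 * ∑ a, ∑ b, t a b * ∑ d, ∑ c, (∑ k, δ k (N d) * δ k (Z c)) *
        (((if a = d then 1 else 0) - N a * N d) * ((if b = c then 1 else 0) - N b * N c)) := by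
  set s : ι → R := fun a ↦ ∑ d, Z d * δ a (N d) with hs
  have hs' : ∀ a, ∑ c, N c * δ a (Z c) = -s a := fun a ↦ by
    have := congrArg (δ a) hNZ
    simp only [map_sum, map_zero, Derivation.leibniz, smul_eq_mul, Finset.sum_add_distrib] at this
    linear_combination this
  -- `δ_k N` is tangential, and the tangential part of `δ_k Z` is `δ_k Z + s_k N`
  have hR : ∀ a b, ∑ d, ∑ c, (∑ k, δ k (N d) * δ k (Z c)) *
        (((if a = d then 1 else 0) - N a * N d) * ((if b = c then 1 else 0) - N b * N c)) =
      ∑ k, δ k (N a) * (δ k (Z b) + N b * s k) := fun a b ↦ by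
    have h1 : ∀ k, ∑ d, δ k (N d) * ((if a = d then 1 else 0) - N a * N d) = δ k (N a) := fun k ↦ by
      have h2 : ∑ d, δ k (N d) * (N a * N d) = 0 := by
        rw [← mul_zero (N a), ← hNδ (N k), Finset.mul_sum]
        exact Finset.sum_congr rfl fun d _ ↦ by rw [hsym k d]; ring
      simp only [mul_sub, Finset.sum_sub_distrib, h2]
      simp
    have h2 : ∀ k, ∑ c, δ k (Z c) * ((if b = c then 1 else 0) - N b * N c) =
        δ k (Z b) + N b * s k := fun k ↦ by
      have h3 : ∑ c, δ k (Z c) * (N b * N c) = N b * ∑ c, N c * δ k (Z c) := by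
        rw [Finset.mul_sum]; exact Finset.sum_congr rfl fun c _ ↦ by ring
      simp only [mul_sub, Finset.sum_sub_distrib, h3, hs' k]
      simp
    simp only [← h2]
    calc _ = ∑ d, ∑ c, ∑ k, (δ k (N d) * ((if a = d then 1 else 0) - N a * N d)) *
          (δ k (Z c) * ((if b = c then 1 else 0) - N b * N c)) := by
          refine Finset.sum_congr rfl fun d _ ↦ Finset.sum_congr rfl fun c _ ↦ ?_
          rw [Finset.sum_mul]
          exact Finset.sum_congr rfl fun k _ ↦ by ring
      _ = ∑ k, ∑ d, ∑ c, (δ k (N d) * ((if a = d then 1 else 0) - N a * N d)) *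
          (δ k (Z c) * ((if b = c then 1 else 0) - N b * N c)) := by
          rw [Finset.sum_comm]
          conv_rhs => rw [Finset.sum_comm]
          rw [Finset.sum_comm]
          exact Finset.sum_congr rfl fun d _ ↦ Finset.sum_comm
      _ = _ := Finset.sum_congr rfl fun k _ ↦ by
          rw [← Finset.sum_mul_sum, h1 k]
  have hL : ∀ a b, ∑ k, δ k (δ k (t a b * (N a * Z b))) = t a b * (-S * (N a * Z b)
      + 2 * (∑ k, δ k (N a) * δ k (Z b))
      + N a * (-2 * ∑ c, δ b (N c) * s c + N b * L)) := fun a b ↦ by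
    have h1 : ∀ k, δ k (δ k (t a b * (N a * Z b))) = t a b * (δ k (δ k (N a)) * Z b +
        2 * (δ k (N a) * δ k (Z b)) + N a * δ k (δ k (Z b))) := fun k ↦ by
      simp only [map_add, Derivation.leibniz, smul_eq_mul, htδ, map_zero]
      ring
    simp only [h1, ← Finset.mul_sum, Finset.sum_add_distrib, ← Finset.sum_mul, hN, hZ]
    ring
  have hw : ∀ a, ∑ k, δ k (N a) * s k = ∑ k, δ a (N k) * s k := fun a ↦
    Finset.sum_congr rfl fun k _ ↦ by rw [hsym]
  have hzero := sum_mul_eq_zero_of_antisymm (f := fun a b ↦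
    -2 * (N a * (∑ k, δ b (N k) * s k) + N b * ∑ k, δ a (N k) * s k) + N a * N b * L) ht
    fun a b ↦ by ring
  have hLS : ∑ k, δ k (δ k (∑ a, ∑ b, t a b * (N a * Z b))) =
      ∑ a, ∑ b, ∑ k, δ k (δ k (t a b * (N a * Z b))) := by
    simp only [map_sum]
    rw [Finset.sum_comm]
    exact Finset.sum_congr rfl fun a _ ↦ Finset.sum_comm
  rw [hLS]
  simp only [hL, hR]
  rw [← sub_eq_zero, ← hzero, Finset.mul_sum, Finset.mul_sum, ← Finset.sum_add_distrib,
    ← Finset.sum_sub_distrib]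
  refine Finset.sum_congr rfl fun a _ ↦ ?_
  rw [Finset.mul_sum, Finset.mul_sum, ← Finset.sum_add_distrib, ← Finset.sum_sub_distrib]
  refine Finset.sum_congr rfl fun b _ ↦ ?_
  have h4 : ∑ k, δ k (N a) * (δ k (Z b) + N b * s k) = ∑ k, δ k (N a) * δ k (Z b) +
      N b * ∑ k, δ a (N k) * s k := by
    rw [← hw a, Finset.mul_sum, ← Finset.sum_add_distrib]
    exact Finset.sum_congr rfl fun k _ ↦ by ring
  rw [h4]; ring

/-! ### Tangential derivatives of functions on the hypersurface -/

section TangentialDerivative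

open scoped RealInnerProductSpace
open FiberBundle VectorField

variable {n : ℕ} {Γ : Submodule ℤ (Euc (n + 1))} [DiscreteTopology Γ]
  {M : Type*} [TopologicalSpace M] [ChartedSpace (Euc n) M]
  {F : M → FlatTorus Γ} {N : M → Euc (n + 1)}

theorem sum_apply_contMDiffMap {ι : Type*} (s : Finset ι) (f : ι → C^∞⟮𝓡 n, M; 𝓘(ℝ, ℝ), ℝ⟯)
    (q : M) : (∑ i ∈ s, f i) q = ∑ i ∈ s, f i q :=
  map_sum (ContMDiffMap.evalRingHom q) f s

/-- The component `N_a = ⟨N, ε_a⟩` of the unit normal, as an element of the ring of smooth functions. -/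
def normalCoord (hN : IsUnitNormal F N) (a : Fin (n + 1)) : C^∞⟮𝓡 n, M; 𝓘(ℝ, ℝ), ℝ⟯ :=
  ⟨fun q ↦ N q a, (EuclideanSpace.proj (𝕜 := ℝ) a).contMDiff.comp hN.contMDiff⟩

theorem normalCoord_apply (hN : IsUnitNormal F N) (a : Fin (n + 1)) (q : M) :
    normalCoord hN a q = N q a := rfl

theorem sum_normalCoord_mul_self (hN : IsUnitNormal F N) :
    ∑ a, normalCoord hN a * normalCoord hN a = 1 := by
  ext q
  have h : ⟪N q, N q⟫ = 1 := by rw [real_inner_self_eq_norm_sq, hN.norm_eq_one]; norm_num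
  rw [sum_apply_contMDiffMap]
  rw [PiLp.inner_apply] at h
  exact h

/-- A double sum over a Parseval frame that involves two bilinear forms of the shape
`(v, w) ↦ ∑ d, β_d(v) (dF w)_d`, as a sum over ambient indices. The frame no longer appears. -/
theorem sum_frame_frame (hF : ∀ p, Function.Injective (diff F p)) {p : M} {ι : Type*}
    [Fintype ι] {e : ι → TangentSpace (𝓡 n) p} (he : IsParsevalFrame F p e)
    (β γ : Fin (n + 1) → TangentSpace (𝓡 n) p →ₗ[ℝ] ℝ) :
    ∑ i, ∑ j, (∑ d, β d (e i) * diff F p (e j) d) * (∑ a, γ a (e i) * diff F p (e j) a) =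
      ∑ d, ∑ a, (∑ k, β d (coordField F k p) * γ a (coordField F k p)) *
        diff F p (coordField F d p) a := by
  have h1 : ∀ d a, ∑ j, diff F p (e j) d * diff F p (e j) a = diff F p (coordField F d p) a :=
    fun d a ↦ by
      have := congrArg (fun v ↦ diff F p v a) (he d)
      simpa [map_sum, map_smul] using this
  have h2 : ∀ d a, ∑ i, β d (e i) * γ a (e i) =
      ∑ k, β d (coordField F k p) * γ a (coordField F k p) := fun d a ↦
    he.sum_apply hF ((LinearMap.mul ℝ ℝ).compl₁₂ (β d) (γ a))
  calc _ = ∑ i, ∑ j, ∑ d, ∑ a, (β d (e i) * γ a (e i)) *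
        (diff F p (e j) d * diff F p (e j) a) := by
        refine Finset.sum_congr rfl fun i _ ↦ Finset.sum_congr rfl fun j _ ↦ ?_
        rw [Finset.sum_mul_sum]
        exact Finset.sum_congr rfl fun d _ ↦ Finset.sum_congr rfl fun a _ ↦ by ring
    _ = ∑ i, ∑ d, ∑ a, (β d (e i) * γ a (e i)) * diff F p (coordField F d p) a := by
        refine Finset.sum_congr rfl fun i _ ↦ ?_
        rw [Finset.sum_comm]
        refine Finset.sum_congr rfl fun d _ ↦ ?_
        rw [Finset.sum_comm]
        refine Finset.sum_congr rfl fun a _ ↦ ?_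
        rw [← h1, Finset.mul_sum]
    _ = _ := by
        rw [Finset.sum_comm]
        refine Finset.sum_congr rfl fun d _ ↦ ?_
        rw [Finset.sum_comm]
        refine Finset.sum_congr rfl fun a _ ↦ ?_
        rw [← h2, Finset.sum_mul]

theorem trace_sum_mul (hF : ∀ p, Function.Injective (diff F p)) (p : M)
    (β : Fin (n + 1) → TangentSpace (𝓡 n) p →ₗ[ℝ] ℝ) :
    trace F p (fun v w ↦ ∑ c, β c v * diff F p w c) = ∑ a, β a (coordField F a p) := by
  rw [trace, Finset.sum_comm]
  refine Finset.sum_congr rfl fun a _ ↦ ?_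
  have := congrArg (β a) (isParsevalFrame_stdFrame hF p a)
  rw [← this, map_sum]
  exact Finset.sum_congr rfl fun i _ ↦ by rw [map_smul, smul_eq_mul, mul_comm]

theorem diff_coordField_eq (hF : ∀ p, Function.Injective (diff F p)) (hN : IsUnitNormal F N)
    (a b : Fin (n + 1)) (q : M) :
    diff F q (coordField F a q) b = ((if a = b then 1 else 0 : C^∞⟮𝓡 n, M; 𝓘(ℝ, ℝ), ℝ⟯) -
      normalCoord hN a * normalCoord hN b) q := by
  rw [diff_coordField hF hN]
  split_ifs <;> rfl

variable [IsManifold (𝓡 n) ∞ M]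

/-- The tangential derivative `δ_a f = df(T_a)`, the `a`-th component of the gradient of `f` as a
vector of `ℝⁿ⁺¹`, as a derivation of the ring of smooth functions. -/
def tangDeriv (hFs : ContMDiff (𝓡 n) 𝓘(ℝ, Euc (n + 1)) ∞ F)
    (hF : ∀ p, Function.Injective (diff F p)) (hN : IsUnitNormal F N) (a : Fin (n + 1)) :
    Derivation ℝ C^∞⟮𝓡 n, M; 𝓘(ℝ, ℝ), ℝ⟯ C^∞⟮𝓡 n, M; 𝓘(ℝ, ℝ), ℝ⟯ :=
  fieldDerivation (coordField F a) (contMDiff_coordField hFs hF hN a)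

section

variable (hFs : ContMDiff (𝓡 n) 𝓘(ℝ, Euc (n + 1)) ∞ F)
    (hF : ∀ p, Function.Injective (diff F p)) (hN : IsUnitNormal F N)

theorem tangDeriv_apply (a : Fin (n + 1)) (f : C^∞⟮𝓡 n, M; 𝓘(ℝ, ℝ), ℝ⟯) (q : M) :
    tangDeriv hFs hF hN a f q = mvfderiv (𝓡 n) f q (coordField F a q) := rfl

theorem sum_normalCoord_mul_tangDeriv (f : C^∞⟮𝓡 n, M; 𝓘(ℝ, ℝ), ℝ⟯) :
    ∑ a, normalCoord hN a * tangDeriv hFs hF hN a f = 0 := by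
  ext q
  have h := congrArg (mvfderiv (𝓡 n) f q) (tangentPart_normal hF hN q)
  rw [tangentPart_eq_sum, map_sum, map_zero] at h
  simpa [sum_apply_contMDiffMap, normalCoord_apply, tangDeriv_apply] using h

theorem sum_normalCoord_mul_tangDeriv_normalCoord (a : Fin (n + 1)) :
    ∑ c, normalCoord hN c * tangDeriv hFs hF hN a (normalCoord hN c) = 0 := by
  have h := congrArg (tangDeriv hFs hF hN a) (sum_normalCoord_mul_self hN)
  simp only [map_sum, Derivation.leibniz, Derivation.map_one_eq_zero, smul_eq_mul,
    Finset.sum_add_distrib] at h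
  exact eq_zero_of_two_mul_eq_zero (by linear_combination h)

/-- The components of `[T_a, T_b]`: since `D` is torsion free and `dF(T_b)` has the components
`δ_bc - N_b N_c`, they are derivatives of products of components of the normal. -/
theorem diff_mlieBracket_coordField (a b c : Fin (n + 1)) (q : M) :
    diff F q (mlieBracket (𝓡 n) (coordField F a) (coordField F b) q) c =
      (tangDeriv hFs hF hN b (normalCoord hN a * normalCoord hN c) -
        tangDeriv hFs hF hN a (normalCoord hN b * normalCoord hN c)) q := by
  rw [diff_mlieBracket hFs (contMDiff_coordField hFs hF hN a q)
    (contMDiff_coordField hFs hF hN b q)]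
  have h : ∀ a b, ambientDeriv F (coordField F b) q (coordField F a q) c =
      -tangDeriv hFs hF hN a (normalCoord hN b * normalCoord hN c) q := fun a b ↦ by
    have h1 : MDifferentiableAt (𝓡 n) 𝓘(ℝ, Euc (n + 1)) (fun q ↦ diff F q (coordField F b q)) q :=
      (contMDiffAt_diff_apply hFs (contMDiff_coordField hFs hF hN b q)).mdifferentiableAt (by simp)
    have h2 := (mvfderiv_coord h1 c (coordField F a q)).2
    have h3 : (fun q ↦ diff F q (coordField F b q) c) =
        ⇑((algebraMap ℝ C^∞⟮𝓡 n, M; 𝓘(ℝ, ℝ), ℝ⟯ (if b = c then 1 else 0)) -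
          normalCoord hN b * normalCoord hN c) := by
      funext q
      rw [diff_coordField hF hN]
      rfl
    rw [h3] at h2
    refine h2.symm.trans ?_
    have h4 := congrArg (fun g ↦ g q) (map_sub (tangDeriv hFs hF hN a)
      (algebraMap ℝ C^∞⟮𝓡 n, M; 𝓘(ℝ, ℝ), ℝ⟯ (if b = c then 1 else 0))
      (normalCoord hN b * normalCoord hN c))
    rw [Derivation.map_algebraMap, zero_sub] at h4
    exact h4
  have h' : ∀ x y : Euc (n + 1), (x - y) c = x c - y c := fun _ _ ↦ rfl
  rw [h', h, h]
  simp only [ContMDiffMap.coe_sub, Pi.sub_apply]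
  ring

/-- The symmetry of the second fundamental form, `δ_a N_b = δ_b N_a`: the bracket `[T_a, T_b]` is
tangential, hence orthogonal to `N`. -/
theorem tangDeriv_normalCoord_comm (a b : Fin (n + 1)) :
    tangDeriv hFs hF hN a (normalCoord hN b) = tangDeriv hFs hF hN b (normalCoord hN a) := by
  have h : ∑ c, normalCoord hN c * (tangDeriv hFs hF hN b (normalCoord hN a * normalCoord hN c) -
        tangDeriv hFs hF hN a (normalCoord hN b * normalCoord hN c)) = 0 := by
    ext q
    have h1 := hN.inner_eq_zero q (mlieBracket (𝓡 n) (coordField F a) (coordField F b) q)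
    rw [PiLp.inner_apply] at h1
    simp only [diff_mlieBracket_coordField hFs hF hN] at h1
    simpa [sum_apply_contMDiffMap, normalCoord_apply] using h1
  have h1 := sum_normalCoord_mul_tangDeriv_normalCoord hFs hF hN a
  have h2 := sum_normalCoord_mul_tangDeriv_normalCoord hFs hF hN b
  have h3 := sum_normalCoord_mul_self hN
  simp only [Derivation.leibniz, smul_eq_mul] at h
  have h4 : ∀ c, normalCoord hN c * (normalCoord hN a * tangDeriv hFs hF hN b (normalCoord hN c) +
      normalCoord hN c * tangDeriv hFs hF hN b (normalCoord hN a) -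
      (normalCoord hN b * tangDeriv hFs hF hN a (normalCoord hN c) +
      normalCoord hN c * tangDeriv hFs hF hN a (normalCoord hN b))) =
      normalCoord hN a * (normalCoord hN c * tangDeriv hFs hF hN b (normalCoord hN c)) -
      normalCoord hN b * (normalCoord hN c * tangDeriv hFs hF hN a (normalCoord hN c)) +
      (normalCoord hN c * normalCoord hN c) * (tangDeriv hFs hF hN b (normalCoord hN a)
       - tangDeriv hFs hF hN a (normalCoord hN b)) := fun c ↦ by ring
  simp only [h4, Finset.sum_add_distrib, Finset.sum_sub_distrib, ← Finset.mul_sum,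
    ← Finset.sum_mul, h1, h2, h3] at h
  linear_combination -h

/-- The commutator of tangential derivatives, from the expansion of `[T_a, T_b]` in the fields `T_c`. -/
theorem tangDeriv_comm (a b : Fin (n + 1)) (f : C^∞⟮𝓡 n, M; 𝓘(ℝ, ℝ), ℝ⟯) :
    tangDeriv hFs hF hN a (tangDeriv hFs hF hN b f) - tangDeriv hFs hF hN b (tangDeriv hFs hF hN a f)
      = ∑ c, (normalCoord hN a * tangDeriv hFs hF hN b (normalCoord hN c) -
        normalCoord hN b * tangDeriv hFs hF hN a (normalCoord hN c)) * tangDeriv hFs hF hN c f := by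
  ext q
  have h1 := mvfderiv_mlieBracket (f.contMDiff q) (contMDiff_coordField hFs hF hN a q)
    (contMDiff_coordField hFs hF hN b q)
  have h2 := congrArg (mvfderiv (𝓡 n) f q) (eq_sum_coordField hF q
    (mlieBracket (𝓡 n) (coordField F a) (coordField F b) q))
  simp only [map_sum, map_smul, diff_mlieBracket_coordField hFs hF hN] at h2
  refine h1.symm.trans (h2.trans ?_)
  simp only [Derivation.leibniz, smul_eq_mul, tangDeriv_normalCoord_comm hFs hF hN b a]
  simp only [sum_apply_contMDiffMap]
  refine Finset.sum_congr rfl fun c _ ↦ ?_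
  simp only [ContMDiffMap.coe_mul, ContMDiffMap.coe_sub, ContMDiffMap.coe_add, Pi.mul_apply,
    Pi.sub_apply, Pi.add_apply, ← tangDeriv_apply hFs hF hN]
  ring

end

end TangentialDerivative

/-! ### The equation in terms of tangential derivatives -/

section Formulas

open scoped RealInnerProductSpace
open FiberBundle VectorField

variable {n : ℕ} {Γ : Submodule ℤ (Euc (n + 1))} [DiscreteTopology Γ]
  {M : Type*} [TopologicalSpace M] [ChartedSpace (Euc n) M]
  {F : M → FlatTorus Γ} {N : M → Euc (n + 1)}

variable [IsManifold (𝓡 n) ∞ M]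

/-- The component `θ(ε_a, ε_b)` of a parallel two-form of the torus, as a smooth function on `M`. -/
def twoFormCoord {θ : FlatTorus Γ → Euc (n + 1) [⋀^Fin 2]→L[ℝ] ℝ}
    (hFs : ContMDiff (𝓡 n) 𝓘(ℝ, Euc (n + 1)) ∞ F) (hθ : IsParallelTwoForm θ)
    (a b : Fin (n + 1)) : C^∞⟮𝓡 n, M; 𝓘(ℝ, ℝ), ℝ⟯ :=
  ⟨fun q ↦ θ (F q) ![EuclideanSpace.single a 1, EuclideanSpace.single b 1],
    (mvfderiv_twoForm_comp hθ hFs _).1⟩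

variable (hFs : ContMDiff (𝓡 n) 𝓘(ℝ, Euc (n + 1)) ∞ F)
    (hF : ∀ p, Function.Injective (diff F p)) (hN : IsUnitNormal F N)
    {α : ∀ q : M, TangentSpace (𝓡 n) q →L[ℝ] ℝ} (hα : IsSmoothOneForm α)

/-- The component `Z_a = α(T_a)` of a one-form `α` of `M`, regarded as a covector of the torus that
vanishes on `N`. -/
def oneFormCoord (a : Fin (n + 1)) : C^∞⟮𝓡 n, M; 𝓘(ℝ, ℝ), ℝ⟯ :=
  ⟨fun q ↦ α q (coordField F a q),
    contMDiff_oneForm_apply hα (contMDiff_coordField hFs hF hN a)⟩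

theorem sum_normalCoord_mul_oneFormCoord :
    ∑ a, normalCoord hN a * oneFormCoord hFs hF hN hα a = 0 := by
  ext q
  have h := congrArg (α q) (tangentPart_normal hF hN q)
  rw [tangentPart_eq_sum, map_sum, map_zero] at h
  rw [sum_apply_contMDiffMap]
  simp only [map_smul] at h
  exact h

/-- Minimality: the divergence of the normal vanishes. -/
theorem sum_tangDeriv_normalCoord (hmin : IsMinimal F N) :
    ∑ a, tangDeriv hFs hF hN a (normalCoord hN a) = 0 := by
  ext q
  have h := hmin q
  have h1 : secondFF F N q = fun v w ↦
      ∑ c, (-(mvfderiv (𝓡 n) (normalCoord hN c) q).toLinearMap) v * diff F q w c := by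
    funext v w
    rw [secondFF_eq_sum hFs hN, ← Finset.sum_neg_distrib]
    exact Finset.sum_congr rfl fun c _ ↦ (neg_mul _ _).symm
  rw [h1, trace_sum_mul hF] at h
  rw [sum_apply_contMDiffMap]
  simp only [LinearMap.neg_apply, Finset.sum_neg_distrib, neg_eq_zero] at h
  exact h

theorem secondFFNormSq_eq (p : M) :
    secondFFNormSq F N p =
      (∑ a, ∑ c, tangDeriv hFs hF hN a (normalCoord hN c) ^ 2) p := by
  let β : Fin (n + 1) → TangentSpace (𝓡 n) p →ₗ[ℝ] ℝ := fun c ↦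
    (mvfderiv (𝓡 n) (normalCoord hN c) p).toLinearMap
  have h1 : secondFFNormSq F N p = ∑ i, ∑ j, (∑ d, β d (stdFrame F p i) *
      diff F p (stdFrame F p j) d) * (∑ a, β a (stdFrame F p i) * diff F p (stdFrame F p j) a) := by
    refine Finset.sum_congr rfl fun i _ ↦ Finset.sum_congr rfl fun j _ ↦ ?_
    rw [secondFF_eq_sum hFs hN, neg_sq, sq]
    rfl
  rw [h1, sum_frame_frame hF (isParsevalFrame_stdFrame hF p)]
  have h2 : ∀ k, ∑ c, tangDeriv hFs hF hN k (normalCoord hN c) ^ 2 =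
      ∑ d, ∑ a, (tangDeriv hFs hF hN k (normalCoord hN d) *
        tangDeriv hFs hF hN k (normalCoord hN a)) * ((if d = a then 1 else 0) -
          normalCoord hN d * normalCoord hN a) := fun k ↦ by
    have h3 : ∑ d, ∑ a, (tangDeriv hFs hF hN k (normalCoord hN d) *
        tangDeriv hFs hF hN k (normalCoord hN a)) * (normalCoord hN d * normalCoord hN a) = 0 := by
      rw [← zero_mul (0 : C^∞⟮𝓡 n, M; 𝓘(ℝ, ℝ), ℝ⟯),
        ← sum_normalCoord_mul_tangDeriv_normalCoord hFs hF hN k, Finset.sum_mul_sum]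
      exact Finset.sum_congr rfl fun d _ ↦ Finset.sum_congr rfl fun a _ ↦ by ring
    simp only [mul_sub, Finset.sum_sub_distrib, h3]
    simp [sq]
  have h4 : ∑ k, ∑ c, tangDeriv hFs hF hN k (normalCoord hN c) ^ 2 =
      ∑ d, ∑ a, (∑ k, tangDeriv hFs hF hN k (normalCoord hN d) *
        tangDeriv hFs hF hN k (normalCoord hN a)) * ((if d = a then 1 else 0) -
          normalCoord hN d * normalCoord hN a) := by
    simp only [h2]
    rw [Finset.sum_comm]
    refine Finset.sum_congr rfl fun d _ ↦ ?_
    rw [Finset.sum_comm]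
    exact Finset.sum_congr rfl fun a _ ↦ (Finset.sum_mul _ _ _).symm
  rw [h4]
  simp only [sum_apply_contMDiffMap, diff_coordField_eq hF hN]
  refine Finset.sum_congr rfl fun d _ ↦ Finset.sum_congr rfl fun a _ ↦ ?_
  exact congrArg (· * _) (sum_apply_contMDiffMap _ (fun k ↦ tangDeriv hFs hF hN k
    (normalCoord hN d) * tangDeriv hFs hF hN k (normalCoord hN a)) p).symm

theorem laplacian_eq (u : C^∞⟮𝓡 n, M; 𝓘(ℝ, ℝ), ℝ⟯) (p : M) :
    laplacian F u p = (∑ a, tangDeriv hFs hF hN a (tangDeriv hFs hF hN a u)) p := by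
  have h1 : nablaOneForm F (fun q ↦ mvfderiv (𝓡 n) u q) p = fun (v w : TangentSpace (𝓡 n) p) ↦
      ∑ c, (mvfderiv (𝓡 n) (tangDeriv hFs hF hN c u) p).toLinearMap v * diff F p w c := by
    funext v w
    exact nablaOneForm_eq_sum (α := fun q ↦ mvfderiv (𝓡 n) u q) hFs hF
      (fun a ↦ (tangDeriv hFs hF hN a u).mdifferentiableAt) v w
  refine (congrArg (trace F p) h1).trans ?_
  rw [trace_sum_mul hF, sum_apply_contMDiffMap]
  rfl

theorem nablaOneForm_eq (p : M) (v w : TangentSpace (𝓡 n) p) :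
    nablaOneForm F α p v w =
      ∑ c, mvfderiv (𝓡 n) (oneFormCoord hFs hF hN hα c) p v * diff F p w c :=
  nablaOneForm_eq_sum hFs hF (fun a ↦ (oneFormCoord hFs hF hN hα a).mdifferentiableAt) v w

theorem codiffOneForm_eq :
    codiffOneForm F α = ⇑(-∑ a, tangDeriv hFs hF hN a (oneFormCoord hFs hF hN hα a)) := by
  funext p
  have h1 : nablaOneForm F α p = fun v w ↦
      ∑ c, (mvfderiv (𝓡 n) (oneFormCoord hFs hF hN hα c) p).toLinearMap v * diff F p w c := by
    funext v w
    exact nablaOneForm_eq hFs hF hN hα p v w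
  rw [codiffOneForm, h1, trace_sum_mul hF]
  refine congrArg Neg.neg ?_
  exact (sum_apply_contMDiffMap Finset.univ
    (fun a ↦ tangDeriv hFs hF hN a (oneFormCoord hFs hF hN hα a)) p).symm

/-- The component `dα(T_a, T_b)` of the exterior derivative of a one-form `α`, written out in the
functions `Z_c` and `N_c`. -/
def extDerivCoord (a b : Fin (n + 1)) : C^∞⟮𝓡 n, M; 𝓘(ℝ, ℝ), ℝ⟯ :=
  ∑ c, (tangDeriv hFs hF hN a (oneFormCoord hFs hF hN hα c) *
      ((if b = c then 1 else 0) - normalCoord hN b * normalCoord hN c) -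
    tangDeriv hFs hF hN b (oneFormCoord hFs hF hN hα c) *
      ((if a = c then 1 else 0) - normalCoord hN a * normalCoord hN c))

theorem codiffTwoForm_extDerivOneForm (p : M) (z : TangentSpace (𝓡 n) p) :
    codiffTwoForm F (extDerivOneForm α) p z =
      -∑ a, ∑ b, tangDeriv hFs hF hN a (extDerivCoord hFs hF hN hα a b) p * diff F p z b := by
  -- `dα` as a bilinear form, which the covariant derivative of a tensor asks for
  let B : ∀ q : M, TangentSpace (𝓡 n) q →ₗ[ℝ] TangentSpace (𝓡 n) q →ₗ[ℝ] ℝ := fun q ↦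
    ∑ c, ((LinearMap.mul ℝ ℝ).compl₁₂ (mvfderiv (𝓡 n) (oneFormCoord hFs hF hN hα c) q).toLinearMap
        ((EuclideanSpace.proj (𝕜 := ℝ) c).comp (diff F q)).toLinearMap -
      ((LinearMap.mul ℝ ℝ).compl₁₂ (mvfderiv (𝓡 n) (oneFormCoord hFs hF hN hα c) q).toLinearMap
        ((EuclideanSpace.proj (𝕜 := ℝ) c).comp (diff F q)).toLinearMap).flip)
  have hB : extDerivOneForm α = fun q v w ↦ B q v w := by
    funext q v w
    rw [extDerivOneForm_eq_sum hFs hF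
      (fun a ↦ (oneFormCoord hFs hF hN hα a).mdifferentiableAt)]
    simp only [B, LinearMap.sum_apply, LinearMap.sub_apply]
    rfl
  have hBT : ∀ a b, (fun q ↦ B q (coordField F a q) (coordField F b q)) =
      ⇑(extDerivCoord hFs hF hN hα a b) := fun a b ↦ by
    funext q
    simp only [B, LinearMap.sum_apply, LinearMap.sub_apply, extDerivCoord, sum_apply_contMDiffMap]
    refine Finset.sum_congr rfl fun c _ ↦ ?_
    refine congrArg₂ (· - ·) ?_ ?_
    · exact congrArg _ (diff_coordField_eq hF hN b c q)
    · exact congrArg _ (diff_coordField_eq hF hN a c q)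
  have h1 : (fun v w ↦ nablaTwoTensor F (extDerivOneForm α) p v w z) = fun v w ↦
      ∑ a, (∑ b, diff F p z b • (mvfderiv (𝓡 n) (extDerivCoord hFs hF hN hα a b) p).toLinearMap) v *
        diff F p w a := by
    funext v w
    rw [hB, nablaTwoTensor_eq_sum hFs hF B (fun a b ↦ by
      rw [hBT]; exact (extDerivCoord hFs hF hN hα a b).mdifferentiableAt)]
    simp only [hBT, LinearMap.sum_apply, LinearMap.smul_apply, Finset.sum_mul, smul_eq_mul]
    refine Finset.sum_congr rfl fun a _ ↦ Finset.sum_congr rfl fun b _ ↦ ?_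
    rw [mul_right_comm, mul_comm (diff F p z b)]
    rfl
  rw [codiffTwoForm, h1, trace_sum_mul hF]
  refine congrArg Neg.neg (Finset.sum_congr rfl fun a _ ↦ ?_)
  rw [LinearMap.sum_apply]
  exact Finset.sum_congr rfl fun b _ ↦ mul_comm _ _

/-- The Hodge Laplacian vanishes on the fields `T_b`. As `dF(T_b)` is `ε_b` only up to a multiple of
`N`, a normal term remains. -/
theorem harmonic_eq (hharm : ∀ p z, hodgeLaplacian F α p z = 0) (b : Fin (n + 1)) :
    tangDeriv hFs hF hN b (∑ a, tangDeriv hFs hF hN a (oneFormCoord hFs hF hN hα a)) +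
      ∑ a, tangDeriv hFs hF hN a (extDerivCoord hFs hF hN hα a b) =
    normalCoord hN b * ∑ a, ∑ c, tangDeriv hFs hF hN a (extDerivCoord hFs hF hN hα a c) *
      normalCoord hN c := by
  ext q
  have h := hharm q (coordField F b q)
  rw [hodgeLaplacian, codiffOneForm_eq hFs hF hN hα, codiffTwoForm_extDerivOneForm hFs hF hN hα] at h
  have h1 : mvfderiv (𝓡 n) (⇑(-∑ a, tangDeriv hFs hF hN a (oneFormCoord hFs hF hN hα a))) q
      (coordField F b q) =
      -tangDeriv hFs hF hN b (∑ a, tangDeriv hFs hF hN a (oneFormCoord hFs hF hN hα a)) q := by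
    have := congrArg (fun g ↦ g q) ((tangDeriv hFs hF hN b).map_neg
      (∑ a, tangDeriv hFs hF hN a (oneFormCoord hFs hF hN hα a)))
    exact this
  rw [h1] at h
  have h2 : (∑ a, ∑ c, tangDeriv hFs hF hN a (extDerivCoord hFs hF hN hα a c) q *
      diff F q (coordField F b q) c) = (∑ a, ∑ c, tangDeriv hFs hF hN a
        (extDerivCoord hFs hF hN hα a c) * ((if b = c then 1 else 0) -
          normalCoord hN b * normalCoord hN c)) q := by
    simp only [sum_apply_contMDiffMap, diff_coordField_eq hF hN]
    rfl
  rw [h2] at h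
  have h3 : ∑ a, ∑ c, tangDeriv hFs hF hN a
        (extDerivCoord hFs hF hN hα a c) * ((if b = c then 1 else 0) -
          normalCoord hN b * normalCoord hN c) =
      ∑ a, tangDeriv hFs hF hN a (extDerivCoord hFs hF hN hα a b) - normalCoord hN b *
      ∑ a, ∑ c, tangDeriv hFs hF hN a (extDerivCoord hFs hF hN hα a c) * normalCoord hN c := by
    rw [Finset.mul_sum, ← Finset.sum_sub_distrib]
    refine Finset.sum_congr rfl fun a _ ↦ ?_
    rw [Finset.mul_sum]
    simp only [mul_sub, Finset.sum_sub_distrib]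
    congr 1
    · simp
    · exact Finset.sum_congr rfl fun c _ ↦ by ring
  rw [h3] at h
  simp only [ContMDiffMap.coe_add, ContMDiffMap.coe_sub, ContMDiffMap.coe_mul, Pi.add_apply,
    Pi.sub_apply, Pi.mul_apply] at h ⊢
  linear_combination -h

theorem testFunction_eq {θ : FlatTorus Γ → Euc (n + 1) [⋀^Fin 2]→L[ℝ] ℝ}
    (hθ : IsParallelTwoForm θ) :
    testFunction F N α θ = ⇑(∑ a, ∑ b, twoFormCoord hFs hθ a b *
      (normalCoord hN a * oneFormCoord hFs hF hN hα b)) := by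
  funext p
  rw [testFunction, innerTwoForm_wedge]
  simp only [sum_apply_contMDiffMap]
  refine Finset.sum_congr rfl fun a _ ↦ Finset.sum_congr rfl fun b _ ↦ ?_
  have h1 : flat (N p) (EuclideanSpace.single a 1) = N p a := by
    simp [flat, EuclideanSpace.inner_single_right]
  rw [h1]
  rfl

theorem sum_mul_sum_comm_of_symm {ι R : Type*} [Fintype ι] [CommRing R] (t P X Y : ι → ι → R)
    (hP : ∀ a b, P a b = P b a) :
    ∑ d, ∑ a, (∑ k, X k d * ∑ b, ∑ c, (t a b * P b c) * Y k c) * P d a =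
      ∑ a, ∑ b, t a b * ∑ d, ∑ c, (∑ k, X k d * Y k c) * (P a d * P b c) := by
  rw [Finset.sum_comm]
  refine Finset.sum_congr rfl fun a _ ↦ ?_
  simp only [Finset.mul_sum, Finset.sum_mul]
  conv_rhs => rw [Finset.sum_comm]
  refine Finset.sum_congr rfl fun d _ ↦ ?_
  rw [Finset.sum_comm]
  refine Finset.sum_congr rfl fun b _ ↦ ?_
  rw [Finset.sum_comm]
  refine Finset.sum_congr rfl fun c _ ↦ Finset.sum_congr rfl fun k _ ↦ ?_
  rw [hP d a]
  ring

/-- The right-hand side of this formula does not involve the frame `e`. -/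
theorem crossTerm_eq {θ : FlatTorus Γ → Euc (n + 1) [⋀^Fin 2]→L[ℝ] ℝ}
    (hθ : IsParallelTwoForm θ) {p : M} {e : Fin n → TangentSpace (𝓡 n) p}
    (he : IsOrthonormalFrameAt F p e) :
    crossTerm F N α θ p e = -(∑ a, ∑ b, twoFormCoord hFs hθ a b * ∑ d, ∑ c,
      (∑ k, tangDeriv hFs hF hN k (normalCoord hN d) *
        tangDeriv hFs hF hN k (oneFormCoord hFs hF hN hα c)) *
        (((if a = d then 1 else 0) - normalCoord hN a * normalCoord hN d) *
          ((if b = c then 1 else 0) - normalCoord hN b * normalCoord hN c))) p := by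
  let β : Fin (n + 1) → TangentSpace (𝓡 n) p →ₗ[ℝ] ℝ := fun d ↦
    (mvfderiv (𝓡 n) (normalCoord hN d) p).toLinearMap
  let γ : Fin (n + 1) → TangentSpace (𝓡 n) p →ₗ[ℝ] ℝ := fun a ↦
    ∑ b, ∑ c, (twoFormCoord hFs hθ a b p * diff F p (coordField F b p) c) •
      (mvfderiv (𝓡 n) (oneFormCoord hFs hF hN hα c) p).toLinearMap
  have h1 : crossTerm F N α θ p e = -∑ i, ∑ j, (∑ d, β d (e i) * diff F p (e j) d) *
      (∑ a, γ a (e i) * diff F p (e j) a) := by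
    rw [← Finset.sum_neg_distrib]
    refine Finset.sum_congr rfl fun i _ ↦ ?_
    rw [← Finset.sum_neg_distrib]
    refine Finset.sum_congr rfl fun j _ ↦ ?_
    rw [secondFF_eq_sum hFs hN, neg_mul, innerTwoForm_wedge]
    refine congrArg Neg.neg (congrArg₂ (· * ·) rfl (Finset.sum_congr rfl fun a _ ↦ ?_))
    have h2 : flat (diff F p (e j)) (EuclideanSpace.single a 1) = diff F p (e j) a := by
      simp [flat, EuclideanSpace.inner_single_right]
    rw [h2]
    simp only [γ, LinearMap.sum_apply, LinearMap.smul_apply, Finset.sum_mul]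
    refine Finset.sum_congr rfl fun b _ ↦ ?_
    have h3 : ambientCovector F p (nablaOneForm F α p (e i)) (EuclideanSpace.single b 1) =
        nablaOneForm F α p (e i) (coordField F b p) := rfl
    rw [h3, nablaOneForm_eq hFs hF hN hα, Finset.mul_sum, Finset.mul_sum]
    refine Finset.sum_congr rfl fun c _ ↦ ?_
    have h4 : θ (F p) ![EuclideanSpace.single a 1, EuclideanSpace.single b 1] =
      twoFormCoord hFs hθ a b p := rfl
    rw [h4, smul_eq_mul]
    simp only [ContinuousLinearMap.coe_coe]
    ring
  rw [h1, sum_frame_frame hF (he.isParsevalFrame hF)]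
  refine congrArg Neg.neg ?_
  have h5 := sum_mul_sum_comm_of_symm (fun a b ↦ twoFormCoord hFs hθ a b p)
    (fun a b ↦ ((if a = b then 1 else 0) - normalCoord hN a * normalCoord hN b :
      C^∞⟮𝓡 n, M; 𝓘(ℝ, ℝ), ℝ⟯) p)
    (fun k d ↦ tangDeriv hFs hF hN k (normalCoord hN d) p)
    (fun k c ↦ tangDeriv hFs hF hN k (oneFormCoord hFs hF hN hα c) p)
    (fun a b ↦ by simp only [mul_comm (normalCoord hN a), eq_comm (a := a)])
  simp only [← diff_coordField_eq hF hN] at h5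
  simp only [sum_apply_contMDiffMap, γ, LinearMap.sum_apply, LinearMap.smul_apply]
  refine h5.trans ?_
  refine Finset.sum_congr rfl fun a _ ↦ Finset.sum_congr rfl fun b _ ↦ ?_
  refine congrArg (_ * ·) ?_
  simp only [sum_apply_contMDiffMap, diff_coordField_eq hF hN]
  refine Finset.sum_congr rfl fun d _ ↦ Finset.sum_congr rfl fun c _ ↦ ?_
  exact congrArg (· * _) (sum_apply_contMDiffMap _ (fun k ↦ tangDeriv hFs hF hN k
    (normalCoord hN d) * tangDeriv hFs hF hN k (oneFormCoord hFs hF hN hα c)) p).symm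

end Formulas

end TorusHypersurface

end

open scoped Manifold ContDiff in
open TorusHypersurface in
theorem mainTheorem3 (n : ℕ) (Γ : Submodule ℤ (Euc (n + 1))) [DiscreteTopology Γ] [IsZLattice ℝ Γ]
    {M : Type*} [TopologicalSpace M] [ChartedSpace (Euc n) M] [IsManifold (𝓡 n) ∞ M]
    [CompactSpace M]
    (F : M → FlatTorus Γ) (hF : Manifold.IsSmoothEmbedding (𝓡 n) 𝓘(ℝ, Euc (n + 1)) ∞ F)
    (N : M → Euc (n + 1)) (hN : IsUnitNormal F N) (hmin : IsMinimal F N)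
    (ω₁ : ∀ q : M, TangentSpace (𝓡 n) q →L[ℝ] ℝ) (hω : IsHarmonicOneForm F ω₁)
    (θ : FlatTorus Γ → Euc (n + 1) [⋀^Fin 2]→L[ℝ] ℝ) (hθ : IsParallelTwoForm θ) :
    ContMDiff (𝓡 n) 𝓘(ℝ, ℝ) ∞ (testFunction F N ω₁ θ) ∧
    (∀ (p : M) (e e' : Fin n → TangentSpace (𝓡 n) p),
      IsOrthonormalFrameAt F p e → IsOrthonormalFrameAt F p e' →
        crossTerm F N ω₁ θ p e = crossTerm F N ω₁ θ p e') ∧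
    ∀ (p : M) (e : Fin n → TangentSpace (𝓡 n) p), IsOrthonormalFrameAt F p e →
      laplacian F (testFunction F N ω₁ θ) p
          + secondFFNormSq F N p * testFunction F N ω₁ θ p =
        -2 * crossTerm F N ω₁ θ p e := by
  have hFs : ContMDiff (𝓡 n) 𝓘(ℝ, Euc (n + 1)) ∞ F := hF.isImmersion.contMDiff
  have hinj : ∀ p, Function.Injective (diff F p) := fun p ↦ injective_diff hF.isImmersion p
  have hα := hω.smooth
  have htest := testFunction_eq hFs hinj hN hα hθ
  refine ⟨htest ▸ ContMDiffMap.contMDiff _, fun p e e' he he' ↦ ?_, fun p e he ↦ ?_⟩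
  · rw [crossTerm_eq hFs hinj hN hα hθ he, crossTerm_eq hFs hinj hN hα hθ he']
  have hsym := tangDeriv_normalCoord_comm hFs hinj hN
  have hcomm := tangDeriv_comm hFs hinj hN
  have hNδ := sum_normalCoord_mul_tangDeriv hFs hinj hN
  have hNZ := sum_normalCoord_mul_oneFormCoord hFs hinj hN hα
  have hH := sum_tangDeriv_normalCoord hFs hinj hN hmin
  obtain ⟨L, hL⟩ := sum_deriv_deriv_harmonic (tangDeriv hFs hinj hN) (normalCoord hN)
    (oneFormCoord hFs hinj hN hα) (extDerivCoord hFs hinj hN hα) _ hNδ hsym hcomm hH hNZ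
    (fun _ _ ↦ rfl) (harmonic_eq hFs hinj hN hα hω.hodgeLaplacian_eq_zero)
  have hmain := sum_deriv_deriv_test (tangDeriv hFs hinj hN) (normalCoord hN)
    (oneFormCoord hFs hinj hN hα) (twoFormCoord hFs hθ) L _ hNδ hsym hNZ
    (fun a b ↦ ContMDiffMap.ext fun q ↦ twoForm_swap (θ (F q)) _ _)
    (fun c a b ↦ ContMDiffMap.ext fun q ↦
      congrArg (· (coordField F c q)) ((mvfderiv_twoForm_comp hθ hFs _).2 q))
    (sum_deriv_deriv_normal (tangDeriv hFs hinj hN) (normalCoord hN) hNδ hsym hcomm hH) hL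
  rw [crossTerm_eq hFs hinj hN hα hθ he, htest, laplacian_eq hFs hinj hN,
    secondFFNormSq_eq hFs hinj hN, mul_neg, neg_mul, neg_neg, two_mul]
  rw [two_mul] at hmain
  exact congrArg (fun f ↦ f p) hmain
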